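/- **Theorem 7.** There is a polynomial $P_3$ with nonnegative coefficients and $P_3(0)=0$ such that the following holds. Let $\Omega\subset\mathbb R^m$ be compact, $\mathcal C$ the space of continuous functions $\Omega\to\mathbb R$ with the supremum norm, $N\ge 1$, $\lambda>0$, $\epsilon\ge 0$ and $f^*\in\mathcal C$. Let $o_1,\dots,o_N$ be i.i.d. random elements of the dual space $\mathcal C^*$ that are Gaussian and centered (all vectors $(o_i(f_1),\dots,o_i(f_n))$ are centered Gaussian), and suppose that $\langle f,g\rangle_S=\mathbb E[o_i(f)o_i(g)]$ is a scalar product on $\mathcal C$; write $\|f\|_S^2=\langle f,f\rangle_S$. Let $e_1,\dots,e_N$ be i.i.d. centered real random variables of unit variance, independent of $(o_1,\dots,o_N)$, and let $y_i=o_i(f^*)+\epsilon e_i$. Let $K(x,x')=\sum_k d_k f^{(k)}(x)f^{(k)}(x')$ be a continuous kernel on $\Omega$, with uniform convergence, where $(f^{(k)})_k$ is a countable family in $\mathcal C$ that is orthonormal for $\langle\cdot,\cdot\rangle_S$, $d_k\ge 0$ and $\sum_k d_k<\infty$. Put $\mathcal O f=(o_1(f),\dots,o_N(f))$, $\mathcal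 O^T y=\sum_i y_io_i$, $(K\mu)(x)=\mu(K(x,\cdot))$ for $\mu\in\mathcal C^*$, and $G=\mathcal O K\mathcal O^T\in\mathbb R^{N\times N}$. The kernel ridge regression predictor is $\hat f^\epsilon_\lambda=\frac1N K\mathcal O^T(\frac1N G+\lambda I_N)^{-1}y$ and its empirical risk is $\hat R^\epsilon(\hat f^\epsilon_\lambda)=\frac1N\sum_{i=1}^N(o_i(\hat f^\epsilon_\lambda)-y_i)^2$. Let $T_K:\mathcal C\to\mathcal C$, $(T_Kf)(x)=\langle f,K(x,\cdot)\rangle_S$, and $\mathrm{Tr}[M]=\sum_k\langle f^{(k)},Mf^{(k)}\rangle_S$. Then $T_K+\theta I$ is invertible on $\mathcal C$ for every $\theta>0$; the equation $\vartheta=\lambda+\frac{\vartheta}{N}\mathrm{Tr}[T_K(T_K+\vartheta I)^{-1}]$ has a unique positive solution $\vartheta=\vartheta(\lambda)$, which is differentiable in $\lambda$; $\hat R^\epsilon(\hat f^\epsilon_\lambda)$ is integrable; and, with $$\tilde R^\epsilon=\partial_\lambda\vartheta(\lambda)\Big(\big\|\big(I-T_K(T_K+\vartheta(\lambda) I)^{-1}\big)f^*\big\|_S^2+\epsilon^2\Big),$$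 $$\left|\mathbb E\big[\hat R^\epsilon(\hat f^\epsilon_\lambda)\big]-\frac{\lambda^2}{\vartheta(\lambda)^2}\tilde R^\epsilon\right|\le P_3\!\left(\frac{\mathrm{Tr}[T_K]}{\lambda N}\right)\tilde R^\epsilon,$$ so in particular the error is at most $\big(\frac1N+P_3(\frac{\mathrm{Tr}[T_K]}{\lambda N})\big)\tilde R^\epsilon$. The same holds, with the same $P_3$, if the $o_i$ are only i.i.d. centered Gaussian processes $(o_i(f))_{f\in\mathcal C}$ with $\mathbb E[o_i(f)o_i(g)]=\langle f,g\rangle_S$ for a scalar product $\langle\cdot,\cdot\rangle_S$ that is continuous on $\mathcal C$ (for instance that of $L^2(\sigma)$ for a finite measure $\sigma$ of full support on $\Omega$), where then $G_{ij}=\sum_k d_k\,o_i(f^{(k)})\,o_j(f^{(k)})$ and $\hat R^\epsilon=\frac1N\big\|\frac1N G(\frac1N G+\lambda I_N)^{-1}y-y\big\|^2$. -/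

import Mathlib

open MeasureTheory ProbabilityTheory

namespace KernelRidge

noncomputable section

/-! ### Kernels, observations and the ridge predictor -/

/-- The tensor product `f ⊗ g`, i.e. the function `(x, x') ↦ f x * g x'`. -/
def tensor {X : Type*} [TopologicalSpace X] (f g : C(X, ℝ)) : C(X × X, ℝ) where
  toFun p := f p.1 * g p.2
  continuous_toFun := by fun_prop

/-- The kernel `K` as a map from the dual space to continuous functions,
`(K μ)(x) = μ (K (x, ·))`. -/
def kernelMap {X : Type*} [TopologicalSpace X] (K : C(X × X, ℝ)) (μ : C(X, ℝ) →L[ℝ] ℝ) :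
    C(X, ℝ) where
  toFun x := μ (K.curry x)
  continuous_toFun := μ.continuous.comp K.curry.continuous

/-- The sampling operator `𝒪 f = (o₁ f, …, o_N f)`. -/
def sampling {X : Type*} [TopologicalSpace X] {N : ℕ} (o : Fin N → C(X, ℝ) →L[ℝ] ℝ)
    (f : C(X, ℝ)) : Fin N → ℝ :=
  fun i => o i f

/-- The adjoint of the sampling operator, `(𝒪ᵀ y)(f) = yᵀ 𝒪 f`. -/
def samplingAdjoint {X : Type*} [TopologicalSpace X] {N : ℕ} (o : Fin N → C(X, ℝ) →L[ℝ] ℝ)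
    (y : Fin N → ℝ) : C(X, ℝ) →L[ℝ] ℝ :=
  ∑ i, y i • o i

/-- The Gram matrix `G = 𝒪 K 𝒪ᵀ`, with entries `o_i (K o_j)`. -/
def gram {X : Type*} [TopologicalSpace X] {N : ℕ} (K : C(X × X, ℝ))
    (o : Fin N → C(X, ℝ) →L[ℝ] ℝ) : Matrix (Fin N) (Fin N) ℝ :=
  Matrix.of fun i j => o i (kernelMap K (o j))

/-- The regularized inverse `(G / N + lam I)⁻¹`. -/
def ridgeInverse {N : ℕ} (G : Matrix (Fin N) (Fin N) ℝ) (lam : ℝ) : Matrix (Fin N) (Fin N) ℝ :=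
  ((1 / (N : ℝ)) • G + lam • (1 : Matrix (Fin N) (Fin N) ℝ))⁻¹

/-- The kernel ridge regression predictor `(1 / N) K 𝒪ᵀ (G / N + lam I)⁻¹ y`. -/
def predictor {X : Type*} [TopologicalSpace X] {N : ℕ} (K : C(X × X, ℝ))
    (o : Fin N → C(X, ℝ) →L[ℝ] ℝ) (lam : ℝ) (y : Fin N → ℝ) : C(X, ℝ) :=
  (1 / (N : ℝ)) • kernelMap K (samplingAdjoint o ((ridgeInverse (gram K o) lam).mulVec y))

/-- The mean squared distance `(1 / N) ‖u - y‖²` between fitted values and labels. -/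
def meanSquare {N : ℕ} (u y : Fin N → ℝ) : ℝ :=
  (1 / (N : ℝ)) * ∑ i, (u i - y i) ^ 2

/-- The empirical risk (training error) `(1 / N) ‖𝒪 f - y‖²` of a function `f`. -/
def empiricalRisk {X : Type*} [TopologicalSpace X] {N : ℕ} (o : Fin N → C(X, ℝ) →L[ℝ] ℝ)
    (y : Fin N → ℝ) (f : C(X, ℝ)) : ℝ :=
  meanSquare (sampling o f) y

/-! ### Spectral matrix representation, for random linear forms that need not be bounded

If the observations are only given through the random variables `o_i (f)`, as for a white noise
on `L²(σ)`, the Gram matrix is the matrix with entries `∑ₖ dₖ o_i(fₖ) o_j(fₖ)`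
and the predictor has the values `(1 / N) G (G / N + lam I)⁻¹ y` on the observations. -/

/-- The Gram matrix in terms of the matrix `O i k = o_i (fₖ)` and of the eigenvalues. -/
def spectralGram {ι : Type*} {N : ℕ} (d : ι → ℝ) (O : Fin N → ι → ℝ) :
    Matrix (Fin N) (Fin N) ℝ :=
  Matrix.of fun i j => ∑' k, d k * O i k * O j k

/-- The values `𝒪 f̂ = (1 / N) G (G / N + lam I)⁻¹ y` of the predictor on the observations. -/
def fittedValues {N : ℕ} (G : Matrix (Fin N) (Fin N) ℝ) (lam : ℝ) (y : Fin N → ℝ) :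
    Fin N → ℝ :=
  ((1 / (N : ℝ)) • G).mulVec ((ridgeInverse G lam).mulVec y)

/-- The noisy labels `y_i = o_i (f) + ε e_i`. -/
def labels {N : ℕ} (u : Fin N → ℝ) (ε : ℝ) (e : Fin N → ℝ) : Fin N → ℝ :=
  fun i => u i + ε * e i

/-- The empirical risk of the predictor trained on the noisy observations of `f`. -/
def trainingRisk {X : Type*} [TopologicalSpace X] {N : ℕ} (K : C(X × X, ℝ)) (lam ε : ℝ)
    (f : C(X, ℝ)) (o : Fin N → C(X, ℝ) →L[ℝ] ℝ) (e : Fin N → ℝ) : ℝ :=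
  empiricalRisk o (labels (sampling o f) ε e)
    (predictor K o lam (labels (sampling o f) ε e))

/-- The same quantity in the spectral matrix representation, where `u i = o_i (f)` and
`O i k = o_i (fₖ)`. -/
def spectralTrainingRisk {ι : Type*} {N : ℕ} (d : ι → ℝ) (lam ε : ℝ) (u : Fin N → ℝ)
    (O : Fin N → ι → ℝ) (e : Fin N → ℝ) : ℝ :=
  meanSquare (fittedValues (spectralGram d O) lam (labels u ε e)) (labels u ε e)

/-! ### Distribution of the observations and of the noise -/

/-- `S` is a scalar product. (It is continuous, being given as a continuous bilinear form.) -/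
structure IsScalarProduct {X : Type*} [TopologicalSpace X]
    (S : C(X, ℝ) →L[ℝ] C(X, ℝ) →L[ℝ] ℝ) : Prop where
  symm : ∀ f g, S f g = S g f
  pos : ∀ f, f ≠ 0 → 0 < S f f

/-- `o₁, …, o_N` (with `o i f` the random variable `o_i (f)`) are i.i.d. centered Gaussian random
linear forms with `𝔼[o_i(f) o_i(g)] = ⟨f, g⟩_S`, the noises `e₁, …, e_N` are i.i.d. with law `ν`,
centered and of unit variance, and the noises are independent of the observations. -/
structure IsNoisyGaussianSample {X : Type*} [TopologicalSpace X] {Ω : Type*} [MeasurableSpace Ω]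
    (P : Measure Ω) (S : C(X, ℝ) →L[ℝ] C(X, ℝ) →L[ℝ] ℝ) {N : ℕ}
    (o : Fin N → C(X, ℝ) → Ω → ℝ) (ν : Measure ℝ) (e : Fin N → Ω → ℝ) : Prop where
  obs_gaussian : ∀ i, IsGaussianProcess (o i) P
  obs_mean : ∀ i f, ∫ ω, o i f ω ∂P = 0
  obs_second_moment : ∀ i f g, ∫ ω, o i f ω * o i g ω ∂P = S f g
  obs_indep : iIndepFun (fun i ω f => o i f ω) P
  noise_law : ∀ i, HasLaw (e i) ν P
  noise_mean : ∫ x, x ∂ν = 0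
  noise_variance : ∫ x, x ^ 2 ∂ν = 1
  noise_indep : iIndepFun e P
  obs_noise_indep : IndepFun (fun ω (p : Fin N × C(X, ℝ)) => o p.1 p.2 ω) (fun ω i => e i ω) P

/-! ### The integral operator, the signal capture threshold and the approximate risk -/

/-- The integral operator `(T_K f)(x) = ⟨f, K (x, ·)⟩_S`. -/
def integralOperator {X : Type*} [TopologicalSpace X] (K : C(X × X, ℝ))
    (S : C(X, ℝ) →L[ℝ] C(X, ℝ) →L[ℝ] ℝ) : Module.End ℝ C(X, ℝ) where
  toFun f := kernelMap K (S f)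
  map_add' f g := by ext x; simp [kernelMap]
  map_smul' c f := by ext x; simp [kernelMap]

/-- The operator `T (T + θ I)⁻¹`. -/
def reconstruction {X : Type*} [TopologicalSpace X] (T : Module.End ℝ C(X, ℝ)) (θ : ℝ) :
    Module.End ℝ C(X, ℝ) :=
  T * Ring.inverse (T + θ • (1 : Module.End ℝ C(X, ℝ)))

/-- The kernel has the expansion `K(x, x') = ∑ₖ dₖ fₖ(x) fₖ(x')`, uniformly convergent, with
continuous functions `fₖ` that are orthonormal for `⟨·,·⟩_S` and with nonnegative eigenvalues `dₖ`
of finite sum. (The topology of `C(X × X, ℝ)` is that of uniform convergence.) -/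
structure IsDiagonalization {X : Type*} [TopologicalSpace X] (K : C(X × X, ℝ))
    (S : C(X, ℝ) →L[ℝ] C(X, ℝ) →L[ℝ] ℝ) {ι : Type*} (d : ι → ℝ) (φ : ι → C(X, ℝ)) : Prop where
  orthogonal : ∀ k l, k ≠ l → S (φ k) (φ l) = 0
  normalized : ∀ k, S (φ k) (φ k) = 1
  nonneg : ∀ k, 0 ≤ d k
  summable : Summable d
  hasSum : HasSum (fun k => d k • tensor (φ k) (φ k)) K

/-- The trace `∑ₖ ⟨fₖ, M fₖ⟩_S`. -/
def opTrace {X : Type*} [TopologicalSpace X] (S : C(X, ℝ) →L[ℝ] C(X, ℝ) →L[ℝ] ℝ)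
    {ι : Type*} (φ : ι → C(X, ℝ)) (M : Module.End ℝ C(X, ℝ)) : ℝ :=
  ∑' k, S (φ k) (M (φ k))

/-- `θ` is a positive solution of `θ = lam + (θ / N) Tr[T_K (T_K + θ I)⁻¹]`. -/
def IsThreshold {X : Type*} [TopologicalSpace X] (K : C(X × X, ℝ))
    (S : C(X, ℝ) →L[ℝ] C(X, ℝ) →L[ℝ] ℝ) {ι : Type*} (φ : ι → C(X, ℝ)) (N : ℕ)
    (lam θ : ℝ) : Prop :=
  0 < θ ∧ θ = lam + θ / N * opTrace S φ (reconstruction (integralOperator K S) θ)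

/-- The signal capture threshold, as a function of the ridge. -/
def threshold {X : Type*} [TopologicalSpace X] (K : C(X × X, ℝ))
    (S : C(X, ℝ) →L[ℝ] C(X, ℝ) →L[ℝ] ℝ) {ι : Type*} (φ : ι → C(X, ℝ)) (N : ℕ)
    (lam : ℝ) : ℝ :=
  Classical.epsilon (IsThreshold K S φ N lam)

/-- The residual `(I - T_K (T_K + ϑ I)⁻¹) f`, where `ϑ` is the signal capture threshold. -/
def residual {X : Type*} [TopologicalSpace X] (K : C(X × X, ℝ))
    (S : C(X, ℝ) →L[ℝ] C(X, ℝ) →L[ℝ] ℝ) {ι : Type*} (φ : ι → C(X, ℝ)) (N : ℕ)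
    (lam : ℝ) (f : C(X, ℝ)) : C(X, ℝ) :=
  f - reconstruction (integralOperator K S) (threshold K S φ N lam) f

/-- The approximate risk `∂ϑ (‖(I - T_K (T_K + ϑ I)⁻¹) f‖_S² + ε²)`. -/
def approxRisk {X : Type*} [TopologicalSpace X] (K : C(X × X, ℝ))
    (S : C(X, ℝ) →L[ℝ] C(X, ℝ) →L[ℝ] ℝ) {ι : Type*} (φ : ι → C(X, ℝ)) (N : ℕ)
    (lam ε : ℝ) (f : C(X, ℝ)) : ℝ :=
  deriv (threshold K S φ N) lam *
    (S (residual K S φ N lam f) (residual K S φ N lam f) + ε ^ 2)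

end

end KernelRidge

/-!
The residuals of ridge regression are `-R y` with `R = (1 + A)⁻¹` and `A = ∑ₖ cₖ xₖ xₖᵀ`, where
`cₖ = dₖ / (lam N)` and the feature vectors `xₖ = 𝒪 fₖ` are independent standard Gaussian vectors of
`ℝᴺ`. So the training error is `|R y|² / N`, and with `t = ∑ₖ cₖ = Tr[T_K] / (lam N)` it suffices to
find its mean up to a relative error that is polynomial in `t` and vanishes with `t`.

* Leave one feature out. By the Sherman–Morrison formula, `|R xₖ|²` equals `s / (1 + cₖ s)²` with
  `s = |xₖ|²`, up to an error that is linear in `q = ⟨xₖ, A' xₖ⟩`, where `A'` is `A` without the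
  term of index `k` (`resolvent_rankOne_bounds`). As `A'` is independent of `xₖ` and has mean
  `∑_{l ≠ k} c_l ≤ t` times the identity, this is a relative error `O(t)` in the mean
  (`abs_integral_diagonal_sub_le`).
* The chi-squared variable `s` has mean `N` and variance `O(N)`, and an exact second-order expansion
  shows that `s / (1 + cₖ s)²` has mean `N / (1 + cₖ N)²` up to a relative error `O(cₖ)`
  (`abs_rankOneMean_sub_le`).
* Different features, and features and noise, are orthogonal in the mean
  (`integral_offDiagonal_eq_zero`, `integral_noisy_energy`), and the noise contributes
  `ε² tr R² / N`, which is `ε²` up to `O(t)` (`abs_integral_frobenius_sub_le`). If the kernel has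
  finite rank, the part of `f*` that is orthogonal to the eigenfunctions is one more feature, of
  weight zero; the general case is the limit of this one, by dominated convergence
  (`abs_integral_spectralTrainingRisk_sub_le`).

This identifies the mean training error with the sum `ridgeRisk` over the eigenfunctions, at the
ridge `lam`. The approximation in the theorem is the same sum at the signal capture threshold `ϑ`,
times `lam² ∂ϑ / ϑ²`. Since `lam ≤ ϑ ≤ lam (1 + t)` and `1 ≤ ∂ϑ ≤ ϑ / lam`, the two agree up to a
relative error `2 t` (`abs_sub_approxRisk_le`). The facts about `ϑ` come from the identity
`sub_mul_inverseSlope` for the difference of two solutions of the threshold equation, and the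
inverse of `T_K + θ` is explicit in the eigenfunctions: the series converges uniformly by the
Cauchy–Schwarz inequality (`summable_smul`, `exists_add_smul_eq`).
-/

namespace KernelRidge

open Matrix

/-! ### Ridge resolvents of positive semidefinite matrices -/

section Resolvent

variable {n : Type*} [Fintype n]

theorem dotProduct_mulVec_symm {A : Matrix n n ℝ} (hA : A.PosSemidef) (u v : n → ℝ) :
    u ⬝ᵥ A *ᵥ v = v ⬝ᵥ A *ᵥ u := by
  have h : Aᵀ = A := by simpa using hA.isHermitian.eq
  rw [dotProduct_mulVec, ← mulVec_transpose, h, dotProduct_comm]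

theorem dotProduct_mulVec_self_nonneg {A : Matrix n n ℝ} (hA : A.PosSemidef) (u : n → ℝ) :
    0 ≤ u ⬝ᵥ A *ᵥ u := by
  simpa using hA.dotProduct_mulVec_nonneg u

/-- The Cauchy–Schwarz inequality for a positive semidefinite form. -/
theorem sq_dotProduct_mulVec_le {A : Matrix n n ℝ} (hA : A.PosSemidef) (u v : n → ℝ) :
    (u ⬝ᵥ A *ᵥ v) ^ 2 ≤ (u ⬝ᵥ A *ᵥ u) * (v ⬝ᵥ A *ᵥ v) := by
  have h := discrim_le_zero (a := v ⬝ᵥ A *ᵥ v) (b := 2 * (u ⬝ᵥ A *ᵥ v)) (c := u ⬝ᵥ A *ᵥ u)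
    fun r => by
      have := dotProduct_mulVec_self_nonneg hA (u + r • v)
      simp only [mulVec_add, mulVec_smul, add_dotProduct, dotProduct_add, smul_dotProduct,
        dotProduct_smul, smul_eq_mul, dotProduct_mulVec_symm hA v u] at this
      linarith
  unfold discrim at h
  linarith

theorem sq_dotProduct_le (u v : n → ℝ) : (u ⬝ᵥ v) ^ 2 ≤ (u ⬝ᵥ u) * (v ⬝ᵥ v) := by
  classical
  simpa using sq_dotProduct_mulVec_le (PosSemidef.one (n := n) (R := ℝ)) u v

theorem dotProduct_self_nonneg' (u : n → ℝ) : 0 ≤ u ⬝ᵥ u := by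
  classical
  simpa using dotProduct_mulVec_self_nonneg (PosSemidef.one (n := n) (R := ℝ)) u

theorem posSemidef_rankOne {c : ℝ} (hc : 0 ≤ c) (z : n → ℝ) :
    (Matrix.of fun i j => c * z i * z j).PosSemidef := by
  have h := (posSemidef_vecMulVec_self_star z).smul hc
  convert h using 1
  ext i j
  simp [vecMulVec_apply, mul_assoc]

theorem rankOne_mulVec (c : ℝ) (z v : n → ℝ) :
    (Matrix.of fun i j => c * z i * z j) *ᵥ v = (c * (z ⬝ᵥ v)) • z := by
  ext i
  simp only [mulVec, dotProduct, of_apply, Pi.smul_apply, smul_eq_mul, Finset.mul_sum,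
    Finset.sum_mul]
  exact Finset.sum_congr rfl fun j _ => by ring

variable [DecidableEq n]

theorem isUnit_one_add {A : Matrix n n ℝ} (hA : A.PosSemidef) : IsUnit (1 + A) :=
  (PosDef.one.add_posSemidef hA).isUnit

theorem resolvent_mulVec_add {A : Matrix n n ℝ} (hA : A.PosSemidef) (z : n → ℝ) :
    (1 + A)⁻¹ *ᵥ z + A *ᵥ ((1 + A)⁻¹ *ᵥ z) = z := by
  have h : (1 + A) *ᵥ ((1 + A)⁻¹ *ᵥ z) = z := by
    rw [mulVec_mulVec, mul_nonsing_inv _ ((isUnit_iff_isUnit_det _).1 (isUnit_one_add hA)),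
      one_mulVec]
  rwa [add_mulVec, one_mulVec] at h

theorem eq_resolvent_mulVec {A : Matrix n n ℝ} (hA : A.PosSemidef) {p z : n → ℝ}
    (h : p + A *ᵥ p = z) : (1 + A)⁻¹ *ᵥ z = p := by
  rw [← h]
  have : p + A *ᵥ p = (1 + A) *ᵥ p := by rw [add_mulVec, one_mulVec]
  rw [this, mulVec_mulVec, nonsing_inv_mul _ ((isUnit_iff_isUnit_det _).1 (isUnit_one_add hA)),
    one_mulVec]

/-- The resolvent `(1 + A)⁻¹` of a positive semidefinite matrix is a contraction. -/
theorem resolvent_contraction {A : Matrix n n ℝ} (hA : A.PosSemidef) (z : n → ℝ) :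
    ((1 + A)⁻¹ *ᵥ z) ⬝ᵥ ((1 + A)⁻¹ *ᵥ z) ≤ z ⬝ᵥ z := by
  have h := resolvent_mulVec_add hA z
  set p := (1 + A)⁻¹ *ᵥ z
  rw [← h]
  simp only [add_dotProduct, dotProduct_add, dotProduct_comm (A *ᵥ p) p]
  have h1 := dotProduct_mulVec_self_nonneg hA p
  have h2 := dotProduct_self_nonneg' (A *ᵥ p)
  linarith

/-- The scalar inequalities behind the bounds on `|(1 + A + c z zᵀ)⁻¹ z|²`. -/
theorem scalar_bounds {a g s q c : ℝ} (ha : 0 ≤ a) (hag : a ≤ g) (hgs : g ≤ s) (hq : 0 ≤ q)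
    (hc : 0 ≤ c) (h1 : g ^ 2 ≤ a * s) (h2 : s ^ 2 ≤ g * (s + q)) :
    (s - 2 * q) / (1 + c * s) ^ 2 ≤ a / (1 + c * g) ^ 2 ∧
      a / (1 + c * g) ^ 2 ≤ (s + q) / (1 + c * s) ^ 2 := by
  have hg : 0 ≤ g := ha.trans hag
  have hs : 0 ≤ s := hg.trans hgs
  have hcg : 0 < 1 + c * g := by positivity
  have hcs : 0 < 1 + c * s := by positivity
  constructor
  · have ha2 : s - 2 * q ≤ a := by
      rcases hs.eq_or_lt with h0 | h0
      · linarith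
      · have h3 : s ^ 4 ≤ a * s * (s + q) ^ 2 := by
          calc s ^ 4 = (s ^ 2) ^ 2 := by ring
            _ ≤ (g * (s + q)) ^ 2 := by gcongr
            _ = g ^ 2 * (s + q) ^ 2 := by ring
            _ ≤ _ := by gcongr
        have h4 : s ^ 3 ≤ a * (s + q) ^ 2 := by
          refine le_of_mul_le_mul_left ?_ h0
          linarith
        have h5 : (s - 2 * q) * (s + q) ^ 2 ≤ a * (s + q) ^ 2 := by
          refine le_trans ?_ h4
          have : 0 ≤ 3 * s * q ^ 2 + 2 * q ^ 3 := by positivity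
          linarith
        exact le_of_mul_le_mul_right h5 (by positivity)
    calc (s - 2 * q) / (1 + c * s) ^ 2 ≤ a / (1 + c * s) ^ 2 := by gcongr
      _ ≤ a / (1 + c * g) ^ 2 := by gcongr
  · have key : g * (1 + c * s) ^ 2 ≤ (s + q) * (1 + c * g) ^ 2 := by
      have e1 : g * s ≤ g * (s + q) := by gcongr; linarith
      have e2 : c * (g * s) ≤ c * (g * (s + q)) := by gcongr
      have e3 : c ^ 2 * (g * s ^ 2) ≤ c ^ 2 * (g * (g * (s + q))) := by gcongr
      linarith
    calc a / (1 + c * g) ^ 2 ≤ g / (1 + c * g) ^ 2 := by gcongr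
      _ ≤ _ := by
        rw [div_le_div_iff₀ (by positivity) (by positivity)]
        exact key

/-- Two-sided bound on `|(1 + A + c z zᵀ)⁻¹ z|²`, which is `|z|² / (1 + c |z|²)²` up to an error
that is linear in `A`. By the Sherman–Morrison formula the vector is `p / (1 + c ⟨z, p⟩)`
with `p = (1 + A)⁻¹ z`. -/
theorem resolvent_rankOne_bounds {A : Matrix n n ℝ} (hA : A.PosSemidef) {c : ℝ} (hc : 0 ≤ c)
    (z : n → ℝ) {B : Matrix n n ℝ} (hB : B = A + Matrix.of fun i j => c * z i * z j) :
    (z ⬝ᵥ z - 2 * (z ⬝ᵥ A *ᵥ z)) / (1 + c * (z ⬝ᵥ z)) ^ 2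
        ≤ ((1 + B)⁻¹ *ᵥ z) ⬝ᵥ ((1 + B)⁻¹ *ᵥ z) ∧
      ((1 + B)⁻¹ *ᵥ z) ⬝ᵥ ((1 + B)⁻¹ *ᵥ z)
        ≤ (z ⬝ᵥ z + z ⬝ᵥ A *ᵥ z) / (1 + c * (z ⬝ᵥ z)) ^ 2 := by
  have hBpos : B.PosSemidef := hB ▸ hA.add (posSemidef_rankOne hc z)
  have hp := resolvent_mulVec_add hA z
  set p := (1 + A)⁻¹ *ᵥ z with hpdef
  have hpA := dotProduct_mulVec_self_nonneg hA p
  have hpp := dotProduct_self_nonneg' p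
  have hAA := dotProduct_self_nonneg' (A *ᵥ p)
  have hg : z ⬝ᵥ p = p ⬝ᵥ p + p ⬝ᵥ A *ᵥ p := by
    conv_lhs => rw [← hp]
    rw [add_dotProduct, dotProduct_comm (A *ᵥ p) p]
  have hs : z ⬝ᵥ z = p ⬝ᵥ p + 2 * (p ⬝ᵥ A *ᵥ p) + (A *ᵥ p) ⬝ᵥ (A *ᵥ p) := by
    conv_lhs => rw [← hp]
    simp only [add_dotProduct, dotProduct_add, dotProduct_comm (A *ᵥ p) p]
    ring
  have hgpos : 0 < 1 + c * (z ⬝ᵥ p) := by rw [hg]; positivity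
  have hx : (1 + B)⁻¹ *ᵥ z = (1 + c * (z ⬝ᵥ p))⁻¹ • p := by
    refine eq_resolvent_mulVec hBpos ?_
    rw [hB, add_mulVec, rankOne_mulVec, mulVec_smul, dotProduct_smul, smul_eq_mul]
    have : (c * ((1 + c * (z ⬝ᵥ p))⁻¹ * (z ⬝ᵥ p))) • z
        = (1 + c * (z ⬝ᵥ p))⁻¹ • (c * (z ⬝ᵥ p)) • z := by
      rw [smul_smul]; congr 1; ring
    rw [this, ← smul_add, ← smul_add, ← add_assoc, hp]
    have h1 : z + (c * (z ⬝ᵥ p)) • z = (1 + c * (z ⬝ᵥ p)) • z := by rw [add_smul, one_smul]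
    rw [h1, smul_smul, inv_mul_cancel₀ hgpos.ne', one_smul]
  have hxx : ((1 + B)⁻¹ *ᵥ z) ⬝ᵥ ((1 + B)⁻¹ *ᵥ z) = p ⬝ᵥ p / (1 + c * (z ⬝ᵥ p)) ^ 2 := by
    rw [hx, smul_dotProduct, dotProduct_smul, smul_eq_mul, smul_eq_mul]
    field_simp
  rw [hxx]
  refine scalar_bounds hpp (by linarith) (by linarith) (dotProduct_mulVec_self_nonneg hA z) hc
    ?_ ?_
  · rw [mul_comm]; exact sq_dotProduct_le z p
  · have h := sq_dotProduct_mulVec_le (PosSemidef.one.add hA) z p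
    rw [add_mulVec, one_mulVec, hp, add_mulVec, one_mulVec, dotProduct_add,
      dotProduct_comm p z] at h
    linarith

end Resolvent

end KernelRidge

namespace KernelRidge

open Matrix

/-! ### Moments of the standard Gaussian vector -/

/-- The standard Gaussian measure on `ℝⁿ`, as a product measure. -/
noncomputable abbrev stdGauss (n : Type*) [Fintype n] : Measure (n → ℝ) :=
  Measure.pi fun _ => gaussianReal 0 1

/-- The variance of the square of a standard Gaussian variable. Its value is `2`, but only
its finiteness matters for the error bound. -/
noncomputable def squareVariance : ℝ := Var[fun x : ℝ => x ^ 2; gaussianReal 0 1]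

theorem squareVariance_nonneg : 0 ≤ squareVariance := variance_nonneg _ _

section StdGauss

theorem memLp_gaussianReal (p : ENNReal) (hp : p ≠ ⊤) :
    MemLp (fun x : ℝ => x) p (gaussianReal 0 1) :=
  memLp_id_gaussianReal' p hp

theorem integral_sq_gaussianReal : ∫ x : ℝ, x ^ 2 ∂gaussianReal 0 1 = 1 := by
  have h := variance_fun_id_gaussianReal (μ := 0) (v := 1)
  rw [variance_eq_integral aemeasurable_id', integral_id_gaussianReal] at h
  simpa using h

theorem memLp_sq_gaussianReal : MemLp (fun x : ℝ => x ^ 2) 2 (gaussianReal 0 1) := by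
  have h := (memLp_gaussianReal 4 (by norm_num)).norm_rpow_div 2
  have e : (4 : ENNReal) / 2 = 2 := by
    refine ((ENNReal.eq_div_iff (by norm_num) (by norm_num)).2 ?_).symm
    norm_num
  rw [e] at h
  simpa using h

variable {n : Type*} [Fintype n]

theorem memLp_stdGauss (i : n) : MemLp (fun z : n → ℝ => z i) 2 (stdGauss n) :=
  (memLp_gaussianReal 2 (by norm_num)).comp_measurePreserving
    (measurePreserving_eval (fun _ : n => gaussianReal 0 1) i)

theorem integrable_mul_stdGauss (i j : n) :
    Integrable (fun z : n → ℝ => z i * z j) (stdGauss n) :=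
  (memLp_stdGauss i).integrable_mul (memLp_stdGauss j)

theorem integrable_dotProduct_self_stdGauss :
    Integrable (fun z : n → ℝ => z ⬝ᵥ z) (stdGauss n) :=
  integrable_finsetSum _ fun i _ => integrable_mul_stdGauss i i

theorem integral_mul_stdGauss [DecidableEq n] (i j : n) :
    ∫ z : n → ℝ, z i * z j ∂stdGauss n = if i = j then 1 else 0 := by
  split_ifs with h
  · subst h
    have := integral_comp_eval (μ := fun _ : n => gaussianReal 0 1) (i := i)
      (f := fun x : ℝ => x ^ 2) (by fun_prop)
    simp only [← pow_two]
    rw [this, integral_sq_gaussianReal]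
  · have hI : iIndepFun (fun (i : n) (z : n → ℝ) => z i) (stdGauss n) :=
      iIndepFun_pi (X := fun _ (x : ℝ) => x) fun _ => aemeasurable_id
    rw [(hI.indepFun h).integral_fun_mul_eq_mul_integral
        (measurable_pi_apply i).aestronglyMeasurable (measurable_pi_apply j).aestronglyMeasurable,
      integral_comp_eval (μ := fun _ : n => gaussianReal 0 1) (f := fun x : ℝ => x) (by fun_prop),
      integral_id_gaussianReal, zero_mul]

theorem integral_dotProduct_self_stdGauss :
    ∫ z : n → ℝ, z ⬝ᵥ z ∂stdGauss n = Fintype.card n := by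
  classical
  simp only [dotProduct]
  rw [integral_finsetSum _ fun i _ => integrable_mul_stdGauss i i]
  simp [integral_mul_stdGauss]

theorem memLp_dotProduct_self_stdGauss :
    MemLp (fun z : n → ℝ => z ⬝ᵥ z) 2 (stdGauss n) := by
  refine memLp_finsetSum _ fun i _ => ?_
  have := memLp_sq_gaussianReal.comp_measurePreserving
    (measurePreserving_eval (fun _ : n => gaussianReal 0 1) i)
  simpa only [Function.comp_def, pow_two] using this

/-- The variance of a chi-squared variable, up to the constant. -/
theorem integral_sq_dotProduct_self_sub :
    ∫ z : n → ℝ, ((Fintype.card n : ℝ) - z ⬝ᵥ z) ^ 2 ∂stdGauss n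
      = squareVariance * Fintype.card n := by
  have h := variance_sum_pi (μ := fun _ : n => gaussianReal 0 1) (X := fun _ x => x ^ 2)
    fun _ => memLp_sq_gaussianReal
  have e : (∑ i : n, fun ω : n → ℝ => (ω i) ^ 2) = fun z : n → ℝ => z ⬝ᵥ z := by
    ext z
    simp [dotProduct, pow_two]
  rw [e, variance_eq_integral memLp_dotProduct_self_stdGauss.aestronglyMeasurable.aemeasurable,
    integral_dotProduct_self_stdGauss] at h
  calc _ = ∫ z : n → ℝ, (z ⬝ᵥ z - (Fintype.card n : ℝ)) ^ 2 ∂stdGauss n :=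
        integral_congr_ae (.of_forall fun z => by dsimp only; ring)
    _ = _ := by
      rw [h]
      simp [squareVariance, mul_comm]

/-- The weight `1 / (1 + c |z|²)²` by which a rank one term `c z zᵀ` shrinks the vector `z`. -/
noncomputable def rankOneWeight (c : ℝ) (z : n → ℝ) : ℝ := ((1 + c * (z ⬝ᵥ z)) ^ 2)⁻¹

@[fun_prop]
theorem measurable_rankOneWeight (c : ℝ) : Measurable (rankOneWeight c : (n → ℝ) → ℝ) := by
  unfold rankOneWeight dotProduct
  fun_prop

theorem rankOneWeight_nonneg (c : ℝ) (z : n → ℝ) : 0 ≤ rankOneWeight c z := by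
  unfold rankOneWeight; positivity

theorem rankOneWeight_le_one {c : ℝ} (hc : 0 ≤ c) (z : n → ℝ) : rankOneWeight c z ≤ 1 := by
  unfold rankOneWeight
  have h := mul_nonneg hc (dotProduct_self_nonneg' z)
  exact inv_le_one_of_one_le₀ (one_le_pow₀ (by linarith))

theorem integrable_mul_rankOneWeight {c : ℝ} (hc : 0 ≤ c) {f : (n → ℝ) → ℝ}
    (hf : Integrable f (stdGauss n)) :
    Integrable (fun z => f z * rankOneWeight c z) (stdGauss n) :=
  hf.mul_bdd (c := 1) (by fun_prop) (.of_forall fun z => by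
    rw [Real.norm_of_nonneg (rankOneWeight_nonneg c z)]
    exact rankOneWeight_le_one hc z)

/-- The expectation of `|z|² / (1 + c |z|²)²`. -/
noncomputable def rankOneMean (n : Type*) [Fintype n] (c : ℝ) : ℝ :=
  ∫ z : n → ℝ, (z ⬝ᵥ z) * rankOneWeight c z ∂stdGauss n

theorem rankOneMean_nonneg (c : ℝ) : 0 ≤ rankOneMean n c :=
  integral_nonneg fun z => mul_nonneg (dotProduct_self_nonneg' z) (rankOneWeight_nonneg c z)

/-- Second-order expansion of `s / (1 + c s)²` around `s = M`. The terms of first order have mean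
zero if `s` has mean `M`; the remainder is at most `2 c (M - s)²`, however large `c M` is. -/
theorem expansion_bounds {c s M : ℝ} (hc : 0 ≤ c) (hs : 0 ≤ s) (hM : 0 ≤ M) :
    s + 2 * (c * M / (1 + c * M)) * (M - s) - 2 * c * (M - s) ^ 2
        ≤ (1 + c * M) ^ 2 * (s * ((1 + c * s) ^ 2)⁻¹) ∧
      (1 + c * M) ^ 2 * (s * ((1 + c * s) ^ 2)⁻¹)
        ≤ s + 2 * (c * M / (1 + c * M)) * (M - s) + 2 * c * (M - s) ^ 2 := by
  have h1 : 0 < 1 + c * M := by positivity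
  have h2 : 0 < 1 + c * s := by positivity
  have e : (1 + c * M) ^ 2 * (s * ((1 + c * s) ^ 2)⁻¹)
      = s + 2 * (c * M / (1 + c * M)) * (M - s)
        - 2 * (c * (M - s) ^ 2) * (1 / ((1 + c * M) * (1 + c * s)))
        + c * (M - s) ^ 2 * (c * s / (1 + c * s) ^ 2) := by
    field_simp
    ring
  have hu : 0 ≤ c * (M - s) ^ 2 := by positivity
  have h3 : 1 / ((1 + c * M) * (1 + c * s)) ≤ 1 := by
    rw [div_le_one (by positivity)]
    have : 0 ≤ c * M + c * s + c * M * (c * s) := by positivity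
    linarith
  have h3' : 0 ≤ 1 / ((1 + c * M) * (1 + c * s)) := by positivity
  have h4 : c * s / (1 + c * s) ^ 2 ≤ 1 := by
    rw [div_le_one (by positivity)]
    have : 0 ≤ c * s := by positivity
    linarith [sq_nonneg (c * s)]
  have h4' : 0 ≤ c * s / (1 + c * s) ^ 2 := by positivity
  have a1 := mul_le_mul_of_nonneg_left h3 hu
  have a2 := mul_nonneg hu h3'
  have a3 := mul_le_mul_of_nonneg_left h4 hu
  have a4 := mul_nonneg hu h4'
  rw [e]
  constructor <;> linarith

/-- `𝔼[|z|² / (1 + c |z|²)²]` is `M / (1 + c M)²` with `M = 𝔼 |z|²`, up to a relative error `O(c)`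
that is uniform in the dimension `M`. -/
theorem abs_rankOneMean_sub_le {c : ℝ} (hc : 0 ≤ c) :
    |rankOneMean n c - (Fintype.card n : ℝ) / (1 + c * Fintype.card n) ^ 2|
      ≤ 2 * squareVariance * c * ((Fintype.card n : ℝ) / (1 + c * Fintype.card n) ^ 2) := by
  set M : ℝ := (Fintype.card n : ℝ) with hM
  have hM0 : 0 ≤ M := by positivity
  have h1 : 0 < 1 + c * M := by positivity
  set r := 2 * (c * M / (1 + c * M))
  have i1 : Integrable (fun z : n → ℝ => z ⬝ᵥ z) (stdGauss n) :=
    integrable_dotProduct_self_stdGauss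
  have i2 : Integrable (fun z : n → ℝ => r * (M - z ⬝ᵥ z)) (stdGauss n) :=
    ((integrable_const _).sub i1).const_mul _
  have i3 : Integrable (fun z : n → ℝ => 2 * c * (M - z ⬝ᵥ z) ^ 2) (stdGauss n) :=
    (((memLp_const M).sub memLp_dotProduct_self_stdGauss).integrable_sq).const_mul _
  have i4 : Integrable (fun z : n → ℝ => (1 + c * M) ^ 2 * ((z ⬝ᵥ z) * rankOneWeight c z))
      (stdGauss n) := (integrable_mul_rankOneWeight hc i1).const_mul _
  have e2 : ∫ z : n → ℝ, r * (M - z ⬝ᵥ z) ∂stdGauss n = 0 := by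
    rw [integral_const_mul, integral_sub (integrable_const _) i1,
      integral_dotProduct_self_stdGauss]
    simp [hM]
  have e3 : ∫ z : n → ℝ, 2 * c * (M - z ⬝ᵥ z) ^ 2 ∂stdGauss n = 2 * c * (squareVariance * M) := by
    rw [integral_const_mul, hM, integral_sq_dotProduct_self_sub]
  have e4 : ∫ z : n → ℝ, (1 + c * M) ^ 2 * ((z ⬝ᵥ z) * rankOneWeight c z) ∂stdGauss n
      = (1 + c * M) ^ 2 * rankOneMean n c := integral_const_mul _ _
  have lo := integral_mono (μ := stdGauss n) ((i1.add i2).sub i3) i4 fun z =>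
    (expansion_bounds hc (dotProduct_self_nonneg' z) hM0).1
  have hi := integral_mono (μ := stdGauss n) i4 ((i1.add i2).add i3) fun z =>
    (expansion_bounds hc (dotProduct_self_nonneg' z) hM0).2
  rw [integral_sub' (i1.add i2) i3, integral_add' i1 i2, e2, e3, e4,
    integral_dotProduct_self_stdGauss] at lo
  rw [integral_add' (i1.add i2) i3, integral_add' i1 i2, e2, e3, e4,
    integral_dotProduct_self_stdGauss] at hi
  have hsq : 0 < (1 + c * M) ^ 2 := by positivity
  have hR : rankOneMean n c = (1 + c * M) ^ 2 * rankOneMean n c / (1 + c * M) ^ 2 := by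
    field_simp
  rw [hR, ← sub_div, abs_div, abs_of_pos hsq, mul_div_assoc', div_le_div_iff_of_pos_right hsq,
    abs_le]
  constructor <;> linarith

end StdGauss

end KernelRidge

namespace KernelRidge

open Matrix

/-! ### Gram matrices with finitely many Gaussian features -/

section Resolvents

variable {κ n : Type*}

/-- The matrix `∑ₖ cₖ xₖ xₖᵀ`, the sum being over `k ∈ s`. -/
def weightedGram (s : Finset κ) (c : κ → ℝ) (x : κ → n → ℝ) : Matrix n n ℝ :=
  ∑ k ∈ s, Matrix.of fun i j => c k * x k i * x k j

theorem weightedGram_apply (s : Finset κ) (c : κ → ℝ) (x : κ → n → ℝ) (i j : n) :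
    weightedGram s c x i j = ∑ k ∈ s, c k * x k i * x k j := by
  simp [weightedGram, Matrix.sum_apply]

variable [Fintype n]

theorem posSemidef_weightedGram (s : Finset κ) {c : κ → ℝ} (hc : ∀ k, 0 ≤ c k)
    (x : κ → n → ℝ) : (weightedGram s c x).PosSemidef :=
  posSemidef_sum s fun k _ => posSemidef_rankOne (hc k) (x k)

theorem dotProduct_weightedGram_mulVec (s : Finset κ) (c : κ → ℝ) (x : κ → n → ℝ) (z : n → ℝ) :
    z ⬝ᵥ weightedGram s c x *ᵥ z = ∑ k ∈ s, c k * (x k ⬝ᵥ z) ^ 2 := by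
  rw [weightedGram, Matrix.sum_mulVec, dotProduct_sum]
  refine Finset.sum_congr rfl fun k _ => ?_
  rw [rankOne_mulVec, dotProduct_smul, smul_eq_mul, dotProduct_comm z]
  ring

variable [DecidableEq n]

/-- The resolvent `(1 + ∑ₖ cₖ xₖ xₖᵀ)⁻¹`. -/
noncomputable def gramResolvent [Fintype κ] (c : κ → ℝ) (x : κ → n → ℝ) : Matrix n n ℝ :=
  (1 + weightedGram Finset.univ c x)⁻¹

theorem abs_resolvent_apply_le_one {A : Matrix n n ℝ} (hA : A.PosSemidef) (i j : n) :
    |(1 + A)⁻¹ i j| ≤ 1 := by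
  have h := resolvent_contraction hA (Pi.single j 1)
  rw [mulVec_single_one, single_dotProduct, Pi.single_eq_same, mul_one] at h
  have h2 : (1 + A)⁻¹ i j * (1 + A)⁻¹ i j ≤ 1 :=
    (Finset.single_le_sum (f := fun i => (1 + A)⁻¹ i j * (1 + A)⁻¹ i j)
      (fun i _ => mul_self_nonneg _) (Finset.mem_univ i)).trans h
  rw [← pow_two] at h2
  exact abs_le_one_iff_mul_self_le_one.2 (by rwa [← pow_two])

section Measurability

variable {α : Type*} [MeasurableSpace α]

theorem measurable_det {M : α → Matrix n n ℝ} (hM : ∀ i j, Measurable fun a => M a i j) :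
    Measurable fun a => (M a).det := by
  simp only [det_apply]
  exact Finset.measurable_sum _ fun σ _ =>
    (Finset.measurable_prod _ fun i _ => hM _ _).const_smul _

theorem measurable_matrix_inv {M : α → Matrix n n ℝ} (hM : ∀ i j, Measurable fun a => M a i j)
    (i j : n) : Measurable fun a => (M a)⁻¹ i j := by
  simp only [inv_def, Ring.inverse_eq_inv', Matrix.smul_apply, smul_eq_mul, adjugate_apply]
  refine (measurable_det hM).inv.mul (measurable_det fun k l => ?_)
  simp only [updateRow_apply]
  split_ifs
  · exact measurable_const
  · exact hM k l

@[fun_prop]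
theorem measurable_gramResolvent_apply [Fintype κ] (c : κ → ℝ) (i j : n) :
    Measurable fun x : κ → n → ℝ => gramResolvent c x i j := by
  refine measurable_matrix_inv (fun k l => ?_) i j
  simp only [Matrix.add_apply, weightedGram_apply]
  fun_prop

end Measurability

end Resolvents

section Features

variable {κ n : Type*} [Fintype n] [Fintype κ]

/-- The joint law of independent standard Gaussian vectors `xₖ`. -/
noncomputable abbrev gaussFeatures (κ n : Type*) [Fintype κ] [Fintype n] :
    Measure (κ → n → ℝ) :=
  Measure.pi fun _ => stdGauss n

theorem memLp_gaussFeatures (k : κ) (i : n) :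
    MemLp (fun x : κ → n → ℝ => x k i) 2 (gaussFeatures κ n) :=
  (memLp_stdGauss i).comp_measurePreserving (measurePreserving_eval (fun _ : κ => stdGauss n) k)

theorem integrable_comp_gaussFeatures {f : (n → ℝ) → ℝ} (hf : Integrable f (stdGauss n))
    (k : κ) : Integrable (fun x : κ → n → ℝ => f (x k)) (gaussFeatures κ n) :=
  (measurePreserving_eval (fun _ : κ => stdGauss n) k).integrable_comp_of_integrable hf

theorem integral_comp_gaussFeatures {f : (n → ℝ) → ℝ} (hf : Integrable f (stdGauss n))
    (k : κ) : ∫ x : κ → n → ℝ, f (x k) ∂gaussFeatures κ n = ∫ z, f z ∂stdGauss n :=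
  integral_comp_eval (μ := fun _ : κ => stdGauss n) hf.aestronglyMeasurable

theorem indepFun_gaussFeatures {k l : κ} (h : k ≠ l) :
    IndepFun (fun x : κ → n → ℝ => x k) (fun x => x l) (gaussFeatures κ n) :=
  (iIndepFun_pi (X := fun _ (z : n → ℝ) => z) (μ := fun _ : κ => stdGauss n)
    fun _ => aemeasurable_id).indepFun h

variable [DecidableEq n]

/-- Averaging over a standard Gaussian vector that is independent of `xₖ` replaces the square of
its inner product with `xₖ` by `|xₖ|²`, also in the presence of a weight depending on `xₖ`. -/
theorem integral_sq_dotProduct_mul_weight {k l : κ} (h : l ≠ k) {c : ℝ} (hc : 0 ≤ c) :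
    Integrable (fun x : κ → n → ℝ => (x l ⬝ᵥ x k) ^ 2 * rankOneWeight c (x k))
        (gaussFeatures κ n) ∧
      ∫ x : κ → n → ℝ, (x l ⬝ᵥ x k) ^ 2 * rankOneWeight c (x k) ∂gaussFeatures κ n
        = rankOneMean n c := by
  have e : (fun x : κ → n → ℝ => (x l ⬝ᵥ x k) ^ 2 * rankOneWeight c (x k))
      = fun x => ∑ i, ∑ j, (x l i * x l j) * (x k i * x k j * rankOneWeight c (x k)) := by
    ext x
    simp only [dotProduct, pow_two]
    rw [Finset.sum_mul_sum, Finset.sum_mul]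
    refine Finset.sum_congr rfl fun i _ => ?_
    rw [Finset.sum_mul]
    exact Finset.sum_congr rfl fun j _ => by ring
  have hf : ∀ i j, Integrable (fun z : n → ℝ => z i * z j) (stdGauss n) := integrable_mul_stdGauss
  have hg : ∀ i j, Integrable (fun z : n → ℝ => z i * z j * rankOneWeight c z) (stdGauss n) :=
    fun i j => integrable_mul_rankOneWeight hc (hf i j)
  have hind : ∀ i j, IndepFun (fun x : κ → n → ℝ => x l i * x l j)
      (fun x => x k i * x k j * rankOneWeight c (x k)) (gaussFeatures κ n) := fun i j =>
    (indepFun_gaussFeatures h).comp (φ := fun z : n → ℝ => z i * z j)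
      (ψ := fun z : n → ℝ => z i * z j * rankOneWeight c z) (by fun_prop) (by fun_prop)
  have hint : ∀ i j, Integrable (fun x : κ → n → ℝ =>
      (x l i * x l j) * (x k i * x k j * rankOneWeight c (x k))) (gaussFeatures κ n) :=
    fun i j => (hind i j).integrable_mul (integrable_comp_gaussFeatures (hf i j) l)
      (integrable_comp_gaussFeatures (hg i j) k)
  rw [e]
  refine ⟨integrable_finsetSum _ fun i _ => integrable_finsetSum _ fun j _ => hint i j, ?_⟩
  rw [integral_finsetSum _ fun i _ => integrable_finsetSum _ fun j _ => hint i j]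
  have hval : ∀ i, ∫ x : κ → n → ℝ, ∑ j, (x l i * x l j) *
      (x k i * x k j * rankOneWeight c (x k)) ∂gaussFeatures κ n
      = ∫ z : n → ℝ, z i * z i * rankOneWeight c z ∂stdGauss n := fun i => by
    rw [integral_finsetSum _ fun j _ => hint i j]
    have : ∀ j, ∫ x : κ → n → ℝ, (x l i * x l j) *
        (x k i * x k j * rankOneWeight c (x k)) ∂gaussFeatures κ n
        = (if i = j then 1 else 0) * ∫ z : n → ℝ, z i * z j * rankOneWeight c z ∂stdGauss n :=
      fun j => by
        rw [(hind i j).integral_fun_mul_eq_mul_integral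
          (integrable_comp_gaussFeatures (hf i j) l).aestronglyMeasurable
          (integrable_comp_gaussFeatures (hg i j) k).aestronglyMeasurable,
          integral_comp_gaussFeatures (hf i j) l, integral_comp_gaussFeatures (hg i j) k,
          integral_mul_stdGauss]
    simp only [this, ite_mul, one_mul, zero_mul, Finset.sum_ite_eq, Finset.mem_univ, if_true]
  simp only [hval]
  rw [← integral_finsetSum _ fun i _ => hg i i, rankOneMean]
  simp only [dotProduct, Finset.sum_mul]

theorem integrable_resolvent_mulVec (c : κ → ℝ) (hc : ∀ k, 0 ≤ c k) {u v : (κ → n → ℝ) → n → ℝ}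
    (hu : ∀ i, MemLp (fun x => u x i) 2 (gaussFeatures κ n))
    (hv : ∀ i, MemLp (fun x => v x i) 2 (gaussFeatures κ n)) :
    Integrable (fun x => (gramResolvent c x *ᵥ u x) ⬝ᵥ (gramResolvent c x *ᵥ v x))
      (gaussFeatures κ n) := by
  have key : ∀ {w : (κ → n → ℝ) → n → ℝ}, (∀ i, MemLp (fun x => w x i) 2 (gaussFeatures κ n)) →
      ∀ i, MemLp (fun x => (gramResolvent c x *ᵥ w x) i) 2 (gaussFeatures κ n) := by
    intro w hw i
    refine memLp_finsetSum _ fun j _ => ?_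
    refine (hw j).of_le (((measurable_gramResolvent_apply c i j).aestronglyMeasurable).mul
      (hw j).aestronglyMeasurable) (.of_forall fun x => ?_)
    rw [norm_mul]
    exact mul_le_of_le_one_left (norm_nonneg _)
      (abs_resolvent_apply_le_one (posSemidef_weightedGram _ hc x) i j)
  exact integrable_finsetSum _ fun i _ => (key hu i).integrable_mul (key hv i)

/-- The polynomial `(2 + 2 C) t + 4 C t²` that bounds the relative error, `C` being the variance
of the square of a standard Gaussian variable. -/
noncomputable def errorFactor (t : ℝ) : ℝ :=
  (2 + 2 * squareVariance) * t + 4 * squareVariance * t ^ 2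

/-- The mean of `|R xₖ|²` is `N / (1 + cₖ N)²` up to the relative error `errorFactor t`. Splitting
off the `k`-th rank one term compares `|R xₖ|²` with `|xₖ|² rankOneWeight cₖ xₖ`, and the
discrepancy has mean at most a constant times `(∑_{l ≠ k} c_l) rankOneMean n cₖ`. -/
theorem abs_integral_diagonal_sub_le {c : κ → ℝ} (hc : ∀ k, 0 ≤ c k) {t : ℝ}
    (ht : ∑ k, c k ≤ t) (k : κ) :
    |∫ x : κ → n → ℝ, (gramResolvent c x *ᵥ x k) ⬝ᵥ (gramResolvent c x *ᵥ x k)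
        ∂gaussFeatures κ n - (Fintype.card n : ℝ) / (1 + c k * Fintype.card n) ^ 2|
      ≤ errorFactor t * ((Fintype.card n : ℝ) / (1 + c k * Fintype.card n) ^ 2) := by
  classical
  set s := Finset.univ.erase k
  set H := rankOneMean n (c k) with hH
  have hHnn : 0 ≤ H := rankOneMean_nonneg _
  have hck : c k ≤ t := (Finset.single_le_sum (fun l _ => hc l) (Finset.mem_univ k)).trans ht
  have ht0 : 0 ≤ t := (hc k).trans hck
  have i1 : Integrable (fun x : κ → n → ℝ => (x k ⬝ᵥ x k) * rankOneWeight (c k) (x k))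
      (gaussFeatures κ n) := integrable_comp_gaussFeatures
    (integrable_mul_rankOneWeight (hc k) integrable_dotProduct_self_stdGauss) k
  have v1 : ∫ x : κ → n → ℝ, (x k ⬝ᵥ x k) * rankOneWeight (c k) (x k) ∂gaussFeatures κ n = H :=
    integral_comp_gaussFeatures
      (integrable_mul_rankOneWeight (hc k) integrable_dotProduct_self_stdGauss) k
  have i2 : Integrable (fun x : κ → n → ℝ =>
      ∑ l ∈ s, c l * ((x l ⬝ᵥ x k) ^ 2 * rankOneWeight (c k) (x k))) (gaussFeatures κ n) :=
    integrable_finsetSum _ fun l hl =>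
      (integral_sq_dotProduct_mul_weight (Finset.ne_of_mem_erase hl) (hc k)).1.const_mul _
  have v2 : ∫ x : κ → n → ℝ, ∑ l ∈ s, c l * ((x l ⬝ᵥ x k) ^ 2 * rankOneWeight (c k) (x k))
      ∂gaussFeatures κ n = (∑ l ∈ s, c l) * H := by
    rw [integral_finsetSum _ fun l hl =>
      (integral_sq_dotProduct_mul_weight (Finset.ne_of_mem_erase hl) (hc k)).1.const_mul _,
      Finset.sum_mul]
    refine Finset.sum_congr rfl fun l hl => ?_
    rw [integral_const_mul,
      (integral_sq_dotProduct_mul_weight (Finset.ne_of_mem_erase hl) (hc k)).2]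
  have hsum : (∑ l ∈ s, c l) ≤ t :=
    (Finset.sum_le_sum_of_subset_of_nonneg (Finset.erase_subset _ _) fun l _ _ => hc l).trans ht
  have hsH : (∑ l ∈ s, c l) * H ≤ t * H := by gcongr
  have i0 := integrable_resolvent_mulVec c hc (u := fun x : κ → n → ℝ => x k)
    (v := fun x => x k) (memLp_gaussFeatures k) (memLp_gaussFeatures k)
  have hb : ∀ x : κ → n → ℝ,
      (x k ⬝ᵥ x k) * rankOneWeight (c k) (x k)
          - 2 * ∑ l ∈ s, c l * ((x l ⬝ᵥ x k) ^ 2 * rankOneWeight (c k) (x k))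
        ≤ (gramResolvent c x *ᵥ x k) ⬝ᵥ (gramResolvent c x *ᵥ x k) ∧
      (gramResolvent c x *ᵥ x k) ⬝ᵥ (gramResolvent c x *ᵥ x k)
        ≤ (x k ⬝ᵥ x k) * rankOneWeight (c k) (x k)
          + ∑ l ∈ s, c l * ((x l ⬝ᵥ x k) ^ 2 * rankOneWeight (c k) (x k)) := fun x => by
    have hsplit : weightedGram Finset.univ c x
        = weightedGram s c x + Matrix.of fun i j => c k * x k i * x k j :=
      (Finset.sum_erase_add _ _ (Finset.mem_univ k)).symm
    have h := resolvent_rankOne_bounds (posSemidef_weightedGram s hc x) (hc k) (x k) hsplit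
    rw [dotProduct_weightedGram_mulVec, div_eq_mul_inv, div_eq_mul_inv, sub_mul, add_mul,
      mul_assoc, Finset.sum_mul] at h
    simpa only [mul_assoc, rankOneWeight, gramResolvent] using h
  have lo := integral_mono (i1.sub (i2.const_mul 2)) i0 fun x => (hb x).1
  have hi := integral_mono i0 (i1.add i2) fun x => (hb x).2
  rw [integral_sub' i1 (i2.const_mul 2), integral_const_mul, v1, v2] at lo
  rw [integral_add' i1 i2, v1, v2] at hi
  set X := ∫ x : κ → n → ℝ, (gramResolvent c x *ᵥ x k) ⬝ᵥ (gramResolvent c x *ᵥ x k)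
    ∂gaussFeatures κ n
  have hHest := abs_rankOneMean_sub_le (n := n) (hc k)
  rw [← hH] at hHest
  set D := (Fintype.card n : ℝ) / (1 + c k * Fintype.card n) ^ 2 with hD
  have hDnn : 0 ≤ D := by positivity
  have hC := squareVariance_nonneg
  have hcD : 2 * squareVariance * c k * D ≤ 2 * squareVariance * t * D := by gcongr
  rw [abs_le] at hHest ⊢
  have hHD : t * H ≤ t * (D + 2 * squareVariance * t * D) := by
    gcongr; linarith
  unfold errorFactor
  constructor <;> linarith [mul_nonneg ht0 hHnn]

/-- Different feature vectors are orthogonal in mean after applying the resolvent, since the law of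
the features is invariant under changing the sign of one of them. -/
theorem integral_offDiagonal_eq_zero (c : κ → ℝ) {k l : κ} (h : k ≠ l) :
    ∫ x : κ → n → ℝ, (gramResolvent c x *ᵥ x k) ⬝ᵥ (gramResolvent c x *ᵥ x l)
      ∂gaussFeatures κ n = 0 := by
  classical
  -- `σ` flips the sign of the `k`-th feature vector only, which leaves every `xₘ xₘᵀ` unchanged.
  let σ : κ → ℝ := fun m => if m = k then -1 else 1
  have hneg : MeasurePreserving (fun a : ℝ => -a) (gaussianReal 0 1) (gaussianReal 0 1) :=
    ⟨measurable_neg, by simpa using gaussianReal_map_neg (μ := 0) (v := 1)⟩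
  have hσ1 : ∀ m, MeasurePreserving (fun a : ℝ => σ m * a) (gaussianReal 0 1)
      (gaussianReal 0 1) := fun m => by
    by_cases hm : m = k
    · simpa [σ, hm] using hneg
    · simp only [σ, hm, if_false, one_mul]
      exact MeasurePreserving.id (gaussianReal 0 1)
  have hF : MeasurePreserving (fun (x : κ → n → ℝ) m i => σ m * x m i) (gaussFeatures κ n)
      (gaussFeatures κ n) :=
    measurePreserving_pi (fun _ : κ => stdGauss n) (fun _ => stdGauss n)
      (f := fun m (z : n → ℝ) i => σ m * z i)
      fun m => measurePreserving_pi (fun _ : n => gaussianReal 0 1) (fun _ => gaussianReal 0 1)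
        fun _ => hσ1 m
  have hσσ : ∀ m, σ m * σ m = 1 := fun m => by by_cases hm : m = k <;> simp [σ, hm]
  have hR : ∀ x : κ → n → ℝ, gramResolvent c (fun m i => σ m * x m i) = gramResolvent c x :=
    fun x => by
      unfold gramResolvent
      congr 2
      ext i j
      simp only [weightedGram_apply]
      refine Finset.sum_congr rfl fun m _ => ?_
      linear_combination c m * x m i * x m j * hσσ m
  have hmeas : Measurable fun x : κ → n → ℝ =>
      (gramResolvent c x *ᵥ x k) ⬝ᵥ (gramResolvent c x *ᵥ x l) := by
    simp only [dotProduct, mulVec]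
    fun_prop
  have hmap := integral_map (μ := gaussFeatures κ n) hF.measurable.aemeasurable
    (f := fun x : κ → n → ℝ => (gramResolvent c x *ᵥ x k) ⬝ᵥ (gramResolvent c x *ᵥ x l))
    hmeas.aestronglyMeasurable
  rw [hF.map_eq] at hmap
  have hk : ∀ x : κ → n → ℝ, (fun i => σ k * x k i) = -x k := fun x => by
    ext i; simp [σ]
  have hl : ∀ x : κ → n → ℝ, (fun i => σ l * x l i) = x l := fun x => by
    ext i; simp [σ, h.symm]
  simp only [hR, hk, hl, mulVec_neg, neg_dotProduct, integral_neg] at hmap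
  exact self_eq_neg.1 hmap

/-- The mean energy of a linear combination of the feature vectors after applying the resolvent. -/
theorem abs_integral_signal_sub_le {c : κ → ℝ} (hc : ∀ k, 0 ≤ c k) {t : ℝ}
    (ht : ∑ k, c k ≤ t) (b : κ → ℝ) :
    |∫ x : κ → n → ℝ, (gramResolvent c x *ᵥ ∑ k, b k • x k) ⬝ᵥ
          (gramResolvent c x *ᵥ ∑ k, b k • x k) ∂gaussFeatures κ n
        - ∑ k, b k ^ 2 * ((Fintype.card n : ℝ) / (1 + c k * Fintype.card n) ^ 2)|
      ≤ errorFactor t *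
        ∑ k, b k ^ 2 * ((Fintype.card n : ℝ) / (1 + c k * Fintype.card n) ^ 2) := by
  classical
  have e : ∀ x : κ → n → ℝ, (gramResolvent c x *ᵥ ∑ k, b k • x k) ⬝ᵥ
      (gramResolvent c x *ᵥ ∑ k, b k • x k) = ∑ k, ∑ l, b k * b l *
        ((gramResolvent c x *ᵥ x k) ⬝ᵥ (gramResolvent c x *ᵥ x l)) := fun x => by
    simp only [mulVec_sum, mulVec_smul, sum_dotProduct]
    refine Finset.sum_congr rfl fun k _ => ?_
    rw [dotProduct_sum]
    refine Finset.sum_congr rfl fun l _ => ?_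
    rw [smul_dotProduct, dotProduct_smul, smul_eq_mul, smul_eq_mul, mul_assoc]
  have hi : ∀ k l, Integrable (fun x : κ → n → ℝ => b k * b l *
      ((gramResolvent c x *ᵥ x k) ⬝ᵥ (gramResolvent c x *ᵥ x l))) (gaussFeatures κ n) :=
    fun k l => (integrable_resolvent_mulVec c hc (memLp_gaussFeatures k)
      (memLp_gaussFeatures l)).const_mul _
  have hI : ∫ x : κ → n → ℝ, (gramResolvent c x *ᵥ ∑ k, b k • x k) ⬝ᵥ
          (gramResolvent c x *ᵥ ∑ k, b k • x k) ∂gaussFeatures κ n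
      = ∑ k, b k ^ 2 * ∫ x : κ → n → ℝ, (gramResolvent c x *ᵥ x k) ⬝ᵥ
          (gramResolvent c x *ᵥ x k) ∂gaussFeatures κ n := by
    simp only [e]
    rw [integral_finsetSum _ fun k _ => integrable_finsetSum _ fun l _ => hi k l]
    refine Finset.sum_congr rfl fun k _ => ?_
    rw [integral_finsetSum _ fun l _ => hi k l]
    simp only [integral_const_mul]
    rw [Finset.sum_eq_single k]
    · rw [pow_two]
    · intro l _ hl
      rw [integral_offDiagonal_eq_zero c hl.symm, mul_zero]
    · simp
  rw [hI, ← Finset.sum_sub_distrib, Finset.mul_sum]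
  refine (Finset.abs_sum_le_sum_abs _ _).trans (Finset.sum_le_sum fun k _ => ?_)
  rw [← mul_sub, abs_mul, abs_of_nonneg (sq_nonneg _)]
  calc _ ≤ b k ^ 2 * _ := mul_le_mul_of_nonneg_left (abs_integral_diagonal_sub_le hc ht k)
        (sq_nonneg _)
    _ = _ := by ring

/-- The mean squared Frobenius norm of the resolvent. -/
theorem abs_integral_frobenius_sub_le {c : κ → ℝ} (hc : ∀ k, 0 ≤ c k) {t : ℝ}
    (ht : ∑ k, c k ≤ t) :
    |∫ x : κ → n → ℝ, ∑ i, (gramResolvent c x *ᵥ Pi.single i 1) ⬝ᵥ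
          (gramResolvent c x *ᵥ Pi.single i 1) ∂gaussFeatures κ n - Fintype.card n|
      ≤ 2 * t * Fintype.card n := by
  have hb : ∀ x : κ → n → ℝ,
      (Fintype.card n : ℝ) - 2 * ∑ k, c k * (x k ⬝ᵥ x k)
        ≤ ∑ i, (gramResolvent c x *ᵥ Pi.single i 1) ⬝ᵥ (gramResolvent c x *ᵥ Pi.single i 1) ∧
      ∑ i, (gramResolvent c x *ᵥ Pi.single i 1) ⬝ᵥ (gramResolvent c x *ᵥ Pi.single i 1)
        ≤ (Fintype.card n : ℝ) := fun x => by
    have hA := posSemidef_weightedGram Finset.univ hc x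
    constructor
    · have h : ∀ i : n, 1 - 2 * ∑ k, c k * x k i ^ 2
          ≤ (gramResolvent c x *ᵥ Pi.single i 1) ⬝ᵥ (gramResolvent c x *ᵥ Pi.single i 1) :=
        fun i => by
          have := (resolvent_rankOne_bounds hA le_rfl (Pi.single i (1 : ℝ))
            (B := weightedGram Finset.univ c x) (by ext; simp)).1
          rw [dotProduct_weightedGram_mulVec] at this
          simpa [gramResolvent] using this
      calc (Fintype.card n : ℝ) - 2 * ∑ k, c k * (x k ⬝ᵥ x k)
          = ∑ i : n, (1 - 2 * ∑ k, c k * x k i ^ 2) := by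
            rw [Finset.sum_sub_distrib, ← Finset.mul_sum, Finset.sum_comm]
            simp [dotProduct, Finset.mul_sum, pow_two]
        _ ≤ _ := Finset.sum_le_sum fun i _ => h i
    · calc _ ≤ ∑ i : n, (1 : ℝ) := Finset.sum_le_sum fun i _ => by
            simpa [gramResolvent] using resolvent_contraction hA (Pi.single i (1 : ℝ))
        _ = _ := by simp
  have i1 : ∀ k, Integrable (fun x : κ → n → ℝ => c k * (x k ⬝ᵥ x k)) (gaussFeatures κ n) :=
    fun k => (integrable_comp_gaussFeatures integrable_dotProduct_self_stdGauss k).const_mul _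
  have i2 : Integrable (fun x : κ → n → ℝ => (2 : ℝ) * ∑ k, c k * (x k ⬝ᵥ x k))
      (gaussFeatures κ n) := (integrable_finsetSum _ fun k _ => i1 k).const_mul _
  have i3 : Integrable (fun x : κ → n → ℝ => ∑ i, (gramResolvent c x *ᵥ Pi.single i 1) ⬝ᵥ
      (gramResolvent c x *ᵥ Pi.single i 1)) (gaussFeatures κ n) :=
    integrable_finsetSum _ fun i _ => integrable_resolvent_mulVec c hc
      (fun _ => memLp_const _) (fun _ => memLp_const _)
  have lo := integral_mono ((integrable_const (Fintype.card n : ℝ)).sub i2) i3 fun x => (hb x).1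
  have hi := integral_mono i3 (integrable_const (Fintype.card n : ℝ)) fun x => (hb x).2
  have v2 : ∫ x : κ → n → ℝ, (2 : ℝ) * ∑ k, c k * (x k ⬝ᵥ x k) ∂gaussFeatures κ n
      = 2 * ((∑ k, c k) * Fintype.card n) := by
    rw [integral_const_mul, integral_finsetSum _ fun k _ => i1 k, Finset.sum_mul]
    congr 1
    refine Finset.sum_congr rfl fun k _ => ?_
    rw [integral_const_mul, integral_comp_gaussFeatures integrable_dotProduct_self_stdGauss,
      integral_dotProduct_self_stdGauss]
  rw [integral_sub' (integrable_const _) i2, v2] at lo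
  simp only [integral_const, probReal_univ, one_smul] at lo hi
  have h1 : (∑ k, c k) * (Fintype.card n : ℝ) ≤ t * Fintype.card n := by gcongr
  have h2 : 0 ≤ (∑ k, c k) * (Fintype.card n : ℝ) :=
    mul_nonneg (Finset.sum_nonneg fun k _ => hc k) (by positivity)
  rw [abs_le]
  constructor <;> linarith

end Features

end KernelRidge

namespace KernelRidge

open Matrix

/-! ### Labels with noise -/

section Noise

theorem energy_add_smul {n : Type*} [Fintype n] [DecidableEq n] (r : Matrix n n ℝ)
    (u v : n → ℝ) (ε : ℝ) :
    (r *ᵥ (u + ε • v)) ⬝ᵥ (r *ᵥ (u + ε • v))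
      = (r *ᵥ u) ⬝ᵥ (r *ᵥ u)
        + (2 * ε * ∑ j, ((r *ᵥ u) ⬝ᵥ (r *ᵥ Pi.single j 1)) * v j
        + ε ^ 2 * ∑ i, ∑ j, ((r *ᵥ Pi.single i 1) ⬝ᵥ (r *ᵥ Pi.single j 1)) * (v i * v j)) := by
  have hv : r *ᵥ v = ∑ j, v j • (r *ᵥ Pi.single j 1) := by
    conv_lhs => rw [pi_eq_sum_univ' v]
    simp only [mulVec_sum, mulVec_smul]
  have h1 : (r *ᵥ u) ⬝ᵥ (r *ᵥ v) = ∑ j, ((r *ᵥ u) ⬝ᵥ (r *ᵥ Pi.single j 1)) * v j := by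
    rw [hv, dotProduct_sum]
    exact Finset.sum_congr rfl fun j _ => by rw [dotProduct_smul, smul_eq_mul, mul_comm]
  have h2 : (r *ᵥ v) ⬝ᵥ (r *ᵥ v)
      = ∑ i, ∑ j, ((r *ᵥ Pi.single i 1) ⬝ᵥ (r *ᵥ Pi.single j 1)) * (v i * v j) := by
    rw [hv, sum_dotProduct]
    refine Finset.sum_congr rfl fun i _ => ?_
    rw [dotProduct_sum]
    refine Finset.sum_congr rfl fun j _ => ?_
    rw [smul_dotProduct, dotProduct_smul, smul_eq_mul, smul_eq_mul]
    ring
  rw [← h1, ← h2]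
  simp only [mulVec_add, mulVec_smul, add_dotProduct, dotProduct_add, smul_dotProduct,
    dotProduct_smul, smul_eq_mul, dotProduct_comm (r *ᵥ v) (r *ᵥ u)]
  ring

variable {κ n Ω : Type*} [Fintype κ] [Fintype n] [DecidableEq n] [MeasurableSpace Ω]
  {P : Measure Ω}

/-- Averaging over the noise splits the mean energy into a signal part and a noise part. -/
theorem integral_noisy_energy [IsProbabilityMeasure P] {Z : Ω → κ → n → ℝ}
    (hZ : HasLaw Z (gaussFeatures κ n) P) {e : n → Ω → ℝ} (he : ∀ i, MemLp (e i) 2 P)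
    (he1 : ∀ i, ∫ ω, e i ω ∂P = 0) (he2 : ∀ i j, ∫ ω, e i ω * e j ω ∂P = if i = j then 1 else 0)
    (hind : IndepFun Z (fun ω i => e i ω) P) {c : κ → ℝ} (hc : ∀ k, 0 ≤ c k) (b : κ → ℝ)
    (ε : ℝ) :
    ∫ ω, (gramResolvent c (Z ω) *ᵥ (∑ k, b k • Z ω k + ε • fun i => e i ω)) ⬝ᵥ
        (gramResolvent c (Z ω) *ᵥ (∑ k, b k • Z ω k + ε • fun i => e i ω)) ∂P
      = ∫ x : κ → n → ℝ, (gramResolvent c x *ᵥ ∑ k, b k • x k) ⬝ᵥ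
          (gramResolvent c x *ᵥ ∑ k, b k • x k) ∂gaussFeatures κ n
        + ε ^ 2 * ∫ x : κ → n → ℝ, ∑ i, (gramResolvent c x *ᵥ Pi.single i 1) ⬝ᵥ
          (gramResolvent c x *ᵥ Pi.single i 1) ∂gaussFeatures κ n := by
  have hu : ∀ i, MemLp (fun x : κ → n → ℝ => (∑ k, b k • x k) i) 2 (gaussFeatures κ n) :=
    fun i => by
      simp only [Finset.sum_apply, Pi.smul_apply, smul_eq_mul]
      exact memLp_finsetSum _ fun k _ => (memLp_gaussFeatures k i).const_mul _
  have hs : ∀ j i, MemLp (fun _ : κ → n → ℝ => (Pi.single j 1 : n → ℝ) i) 2 (gaussFeatures κ n) :=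
    fun j i => memLp_const _
  set T : (κ → n → ℝ) → ℝ := fun x => (gramResolvent c x *ᵥ ∑ k, b k • x k) ⬝ᵥ
    (gramResolvent c x *ᵥ ∑ k, b k • x k) with hT
  set T1 : n → (κ → n → ℝ) → ℝ := fun j x => (gramResolvent c x *ᵥ ∑ k, b k • x k) ⬝ᵥ
    (gramResolvent c x *ᵥ Pi.single j 1) with hT1
  set T2 : n → n → (κ → n → ℝ) → ℝ := fun i j x => (gramResolvent c x *ᵥ Pi.single i 1) ⬝ᵥ
    (gramResolvent c x *ᵥ Pi.single j 1) with hT2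
  have iT : Integrable T (gaussFeatures κ n) := integrable_resolvent_mulVec c hc hu hu
  have iT1 : ∀ j, Integrable (T1 j) (gaussFeatures κ n) := fun j =>
    integrable_resolvent_mulVec c hc hu (hs j)
  have iT2 : ∀ i j, Integrable (T2 i j) (gaussFeatures κ n) := fun i j =>
    integrable_resolvent_mulVec c hc (hs i) (hs j)
  have mT1 : ∀ j, Measurable (T1 j) := fun j => by
    simp only [hT1, dotProduct, mulVec, Finset.sum_apply, Pi.smul_apply]
    fun_prop
  have mT2 : ∀ i j, Measurable (T2 i j) := fun i j => by
    simp only [hT2, dotProduct, mulVec]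
    fun_prop
  have pull : ∀ {f : (κ → n → ℝ) → ℝ}, Integrable f (gaussFeatures κ n) →
      Integrable (fun ω => f (Z ω)) P := fun {f} hf => by
    rw [← hZ.map_eq] at hf
    exact hf.comp_aemeasurable hZ.aemeasurable
  have ie : ∀ i, Integrable (e i) P := fun i => (he i).integrable (by norm_num)
  have iee : ∀ i j, Integrable (fun ω => e i ω * e j ω) P := fun i j =>
    (he i).integrable_mul (he j)
  have ind1 : ∀ j, IndepFun (fun ω => T1 j (Z ω)) (e j) P := fun j =>
    hind.comp (mT1 j) (measurable_pi_apply j)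
  have ind2 : ∀ i j, IndepFun (fun ω => T2 i j (Z ω)) (fun ω => e i ω * e j ω) P := fun i j =>
    hind.comp (ψ := fun v : n → ℝ => v i * v j) (mT2 i j) (by fun_prop)
  have i1 : ∀ j, Integrable (fun ω => T1 j (Z ω) * e j ω) P := fun j =>
    (ind1 j).integrable_mul (pull (iT1 j)) (ie j)
  have i2 : ∀ i j, Integrable (fun ω => T2 i j (Z ω) * (e i ω * e j ω)) P := fun i j =>
    (ind2 i j).integrable_mul (pull (iT2 i j)) (iee i j)
  have I1 : Integrable (fun ω => 2 * ε * ∑ j, T1 j (Z ω) * e j ω) P :=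
    (integrable_finsetSum _ fun j _ => i1 j).const_mul _
  have I2 : Integrable (fun ω => ε ^ 2 * ∑ i, ∑ j, T2 i j (Z ω) * (e i ω * e j ω)) P :=
    (integrable_finsetSum _ fun i _ => integrable_finsetSum _ fun j _ => i2 i j).const_mul _
  have I12 : Integrable (fun ω => 2 * ε * ∑ j, T1 j (Z ω) * e j ω
      + ε ^ 2 * ∑ i, ∑ j, T2 i j (Z ω) * (e i ω * e j ω)) P := I1.add I2
  have hexp : ∀ ω, (gramResolvent c (Z ω) *ᵥ (∑ k, b k • Z ω k + ε • fun i => e i ω)) ⬝ᵥ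
      (gramResolvent c (Z ω) *ᵥ (∑ k, b k • Z ω k + ε • fun i => e i ω))
      = T (Z ω) + (2 * ε * ∑ j, T1 j (Z ω) * e j ω
        + ε ^ 2 * ∑ i, ∑ j, T2 i j (Z ω) * (e i ω * e j ω)) := fun ω => energy_add_smul _ _ _ _
  simp only [hexp]
  rw [integral_add (pull iT) I12, integral_add I1 I2]
  have e0 : ∫ ω, T (Z ω) ∂P = ∫ x, T x ∂gaussFeatures κ n :=
    hZ.integral_comp iT.aestronglyMeasurable
  have e1 : ∫ ω, 2 * ε * ∑ j, T1 j (Z ω) * e j ω ∂P = 0 := by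
    rw [integral_const_mul, integral_finsetSum _ fun j _ => i1 j]
    rw [Finset.sum_eq_zero, mul_zero]
    intro j _
    rw [(ind1 j).integral_fun_mul_eq_mul_integral (pull (iT1 j)).aestronglyMeasurable
      (ie j).aestronglyMeasurable, he1, mul_zero]
  have e2 : ∫ ω, ε ^ 2 * ∑ i, ∑ j, T2 i j (Z ω) * (e i ω * e j ω) ∂P
      = ε ^ 2 * ∫ x, ∑ i, T2 i i x ∂gaussFeatures κ n := by
    rw [integral_const_mul,
      integral_finsetSum _ fun i _ => integrable_finsetSum _ fun j _ => i2 i j,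
      integral_finsetSum _ fun i _ => iT2 i i]
    congr 1
    refine Finset.sum_congr rfl fun i _ => ?_
    rw [integral_finsetSum _ fun j _ => i2 i j]
    have : ∀ j, ∫ ω, T2 i j (Z ω) * (e i ω * e j ω) ∂P
        = (∫ ω, T2 i j (Z ω) ∂P) * if i = j then 1 else 0 := fun j => by
      rw [(ind2 i j).integral_fun_mul_eq_mul_integral (pull (iT2 i j)).aestronglyMeasurable
        (iee i j).aestronglyMeasurable, he2]
    simp only [this, mul_ite, mul_one, mul_zero, Finset.sum_ite_eq, Finset.mem_univ, if_true]
    exact hZ.integral_comp (iT2 i i).aestronglyMeasurable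
  rw [e0, e1, e2, zero_add]

end Noise

/-! ### The joint law of the observations -/

section Sample

variable {X : Type*} [TopologicalSpace X] {Ω : Type*} [MeasurableSpace Ω] {P : Measure Ω}
  {S : C(X, ℝ) →L[ℝ] C(X, ℝ) →L[ℝ] ℝ} {N : ℕ} {o : Fin N → C(X, ℝ) → Ω → ℝ} {ν : Measure ℝ}
  {e : Fin N → Ω → ℝ}

theorem IsNoisyGaussianSample.memLp_obs (h : IsNoisyGaussianSample P S o ν e) (i : Fin N)
    (f : C(X, ℝ)) : MemLp (o i f) 2 P :=
  ((h.obs_gaussian i).hasGaussianLaw_eval f).memLp_two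

theorem IsNoisyGaussianSample.memLp_noise (h : IsNoisyGaussianSample P S o ν e) (i : Fin N) :
    MemLp (e i) 2 P := by
  have hν : MemLp (fun x : ℝ => x) 2 ν := by
    refine (memLp_two_iff_integrable_sq (f := fun x : ℝ => x) aestronglyMeasurable_id).2 ?_
    by_contra hn
    have := h.noise_variance
    rw [integral_undef hn] at this
    exact zero_ne_one this
  rw [← (h.noise_law i).map_eq] at hν
  exact hν.comp_of_map (h.noise_law i).aemeasurable

theorem IsNoisyGaussianSample.integral_noise (h : IsNoisyGaussianSample P S o ν e) (i : Fin N) :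
    ∫ ω, e i ω ∂P = 0 := by
  rw [(h.noise_law i).integral_eq, h.noise_mean]

theorem IsNoisyGaussianSample.integral_noise_mul (h : IsNoisyGaussianSample P S o ν e)
    (i j : Fin N) : ∫ ω, e i ω * e j ω ∂P = if i = j then 1 else 0 := by
  split_ifs with hij
  · subst hij
    have := (h.noise_law i).integral_comp (f := fun x : ℝ => x ^ 2) (by fun_prop)
    rw [h.noise_variance] at this
    simpa only [Function.comp_def, pow_two] using this
  · rw [(h.noise_indep.indepFun hij).integral_fun_mul_eq_mul_integral
      (h.memLp_noise i).aestronglyMeasurable (h.memLp_noise j).aestronglyMeasurable,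
      h.integral_noise, zero_mul]

/-- The observations of finitely many `S`-orthonormal functions are independent standard Gaussian
vectors. -/
theorem IsNoisyGaussianSample.hasLaw_features [IsProbabilityMeasure P]
    (h : IsNoisyGaussianSample P S o ν e)
    {κ : Type*} [Fintype κ] {ψ : κ → C(X, ℝ)} (h0 : ∀ k l, k ≠ l → S (ψ k) (ψ l) = 0)
    (h1 : ∀ k, S (ψ k) (ψ k) = 1) :
    HasLaw (fun ω k i => o i (ψ k) ω) (gaussFeatures κ (Fin N)) P := by
  have hrow : ∀ i, HasGaussianLaw (fun ω k => o i (ψ k) ω) P := fun i => by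
    have h2 := ((h.obs_gaussian i).comp_right ψ).hasGaussianLaw Finset.univ
    exact h2.map_fun (ContinuousLinearMap.pi fun k =>
      ContinuousLinearMap.proj (⟨k, Finset.mem_univ k⟩ : (Finset.univ : Finset κ)))
  have hrowind : iIndepFun (fun i ω k => o i (ψ k) ω) P :=
    h.obs_indep.comp (fun _ g k => g (ψ k)) fun _ => by fun_prop
  have hcol : HasGaussianLaw (fun ω k i => o i (ψ k) ω) P :=
    (iIndepFun.hasGaussianLaw hrow hrowind).map_fun (ContinuousLinearMap.pi fun k : κ =>
      ContinuousLinearMap.pi fun i : Fin N =>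
        (ContinuousLinearMap.proj (R := ℝ) (φ := fun _ : κ => ℝ) k).comp
          (ContinuousLinearMap.proj (R := ℝ) (φ := fun _ : Fin N => κ → ℝ) i))
  have hcolind : iIndepFun (fun k ω i => o i (ψ k) ω) P := by
    refine HasGaussianLaw.iIndepFun_of_covariance_eval (X := fun k i => o i (ψ k)) hcol ?_
    intro k l hkl i j
    rw [covariance_eq_sub (h.memLp_obs i _) (h.memLp_obs j _), h.obs_mean, zero_mul, sub_zero]
    by_cases hij : i = j
    · subst hij
      exact (h.obs_second_moment i _ _).trans (h0 k l hkl)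
    · have hI : IndepFun (o i (ψ k)) (o j (ψ l)) P :=
        (h.obs_indep.indepFun hij).comp (measurable_pi_apply (ψ k)) (measurable_pi_apply (ψ l))
      rw [hI.integral_mul_eq_mul_integral (h.memLp_obs i _).aestronglyMeasurable
        (h.memLp_obs j _).aestronglyMeasurable, h.obs_mean, zero_mul]
  refine hcolind.hasLaw_pi fun k => ?_
  have hone : ∀ i, HasLaw (o i (ψ k)) (gaussianReal 0 1) P := fun i => by
    have hg := (h.obs_gaussian i).hasGaussianLaw_eval (ψ k)
    refine ⟨hg.aemeasurable, ?_⟩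
    rw [hg.map_eq_gaussianReal, h.obs_mean, variance_eq_integral hg.aemeasurable, h.obs_mean]
    have := h.obs_second_moment i (ψ k) (ψ k)
    rw [h1] at this
    simp only [sub_zero, pow_two, this, Real.toNNReal_one]
  have hindi : iIndepFun (fun i => o i (ψ k)) P :=
    h.obs_indep.comp (fun _ g => g (ψ k)) fun _ => by fun_prop
  exact hindi.hasLaw_pi hone

theorem IsNoisyGaussianSample.indepFun_features (h : IsNoisyGaussianSample P S o ν e)
    {κ : Type*} (ψ : κ → C(X, ℝ)) :
    IndepFun (fun ω k i => o i (ψ k) ω) (fun ω i => e i ω) P :=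
  h.obs_noise_indep.comp (φ := fun (g : Fin N × C(X, ℝ) → ℝ) (k : κ) (i : Fin N) => g (i, ψ k))
    (by fun_prop) measurable_id

end Sample

end KernelRidge

namespace KernelRidge

open Matrix

/-! ### The mean training error for finitely many features -/

section Finite

/-- The squared norm `|r y|²`. -/
def energy {n : Type*} [Fintype n] (r : Matrix n n ℝ) (y : n → ℝ) : ℝ := (r *ᵥ y) ⬝ᵥ (r *ᵥ y)

variable {X : Type*} [TopologicalSpace X] {Ω : Type*} [MeasurableSpace Ω] {P : Measure Ω}
  {S : C(X, ℝ) →L[ℝ] C(X, ℝ) →L[ℝ] ℝ} {N : ℕ} {o : Fin N → C(X, ℝ) → Ω → ℝ} {ν : Measure ℝ}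
  {e : Fin N → Ω → ℝ}

/-- The observations are almost surely linear: the square of a linear combination has mean
`⟨g, g⟩_S`, where `g` is the corresponding linear combination of functions. -/
theorem IsNoisyGaussianSample.ae_sum_eq_zero (h : IsNoisyGaussianSample P S o ν e) (i : Fin N)
    {κ : Type*} [Fintype κ] {a : κ → ℝ} {g : κ → C(X, ℝ)} (hg : ∑ k, a k • g k = 0) :
    ∀ᵐ ω ∂P, ∑ k, a k * o i (g k) ω = 0 := by
  have hm : MemLp (fun ω => ∑ k, a k * o i (g k) ω) 2 P :=
    memLp_finsetSum _ fun k _ => (h.memLp_obs i (g k)).const_mul (a k)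
  have hi : ∀ k l, Integrable (fun ω => a k * a l * (o i (g k) ω * o i (g l) ω)) P := fun k l =>
    ((h.memLp_obs i (g k)).integrable_mul (h.memLp_obs i (g l))).const_mul _
  have e1 : ∀ ω, (∑ k, a k * o i (g k) ω) ^ 2
      = ∑ k, ∑ l, a k * a l * (o i (g k) ω * o i (g l) ω) := fun ω => by
    rw [pow_two, Finset.sum_mul_sum]
    exact Finset.sum_congr rfl fun k _ => Finset.sum_congr rfl fun l _ => by ring
  have h0 : ∫ ω, (∑ k, a k * o i (g k) ω) ^ 2 ∂P = 0 := by
    simp only [e1]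
    rw [integral_finsetSum _ fun k _ => integrable_finsetSum _ fun l _ => hi k l]
    have : ∀ k, ∫ ω, ∑ l, a k * a l * (o i (g k) ω * o i (g l) ω) ∂P
        = a k * S (g k) (∑ l, a l • g l) := fun k => by
      rw [integral_finsetSum _ fun l _ => hi k l, map_sum, Finset.mul_sum]
      refine Finset.sum_congr rfl fun l _ => ?_
      rw [integral_const_mul, h.obs_second_moment, map_smul, smul_eq_mul]
      ring
    simp [this, hg]
  rw [integral_eq_zero_iff_of_nonneg (fun ω => sq_nonneg _) hm.integrable_sq] at h0
  filter_upwards [h0] with ω hω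
  simpa using hω

variable [IsProbabilityMeasure P]

/-- The mean training error, multiplied by `N`, if `f` and the eigenfunctions of the kernel are
spanned by finitely many `S`-orthonormal functions. -/
theorem IsNoisyGaussianSample.abs_integral_energy_sub_le (h : IsNoisyGaussianSample P S o ν e)
    {κ : Type*} [Fintype κ] {ψ : κ → C(X, ℝ)} (h0 : ∀ k l, k ≠ l → S (ψ k) (ψ l) = 0)
    (h1 : ∀ k, S (ψ k) (ψ k) = 1) {c : κ → ℝ} (hc : ∀ k, 0 ≤ c k) {t : ℝ}
    (ht : ∑ k, c k ≤ t) {b : κ → ℝ} (ε : ℝ) {f : C(X, ℝ)} (hf : f = ∑ k, b k • ψ k) :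
    |∫ ω, energy (gramResolvent c fun k i => o i (ψ k) ω)
          (labels (fun i => o i f ω) ε fun i => e i ω) ∂P
        - N * (∑ k, b k ^ 2 / (1 + c k * N) ^ 2 + ε ^ 2)|
      ≤ errorFactor t * (N * (∑ k, b k ^ 2 / (1 + c k * N) ^ 2 + ε ^ 2)) := by
  classical
  have hae : ∀ᵐ ω ∂P, (labels (fun i => o i f ω) ε fun i => e i ω)
      = ∑ k, b k • (fun i => o i (ψ k) ω) + ε • fun i => e i ω := by
    have hlin : ∀ i : Fin N, ∀ᵐ ω ∂P, o i f ω = ∑ k, b k * o i (ψ k) ω := fun i => by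
      have := h.ae_sum_eq_zero i (κ := Option κ) (a := fun k => k.elim (-1) b)
        (g := fun k => k.elim f ψ) (by simp [Fintype.sum_option, ← hf])
      filter_upwards [this] with ω hω
      simp only [Fintype.sum_option, Option.elim] at hω
      linarith
    filter_upwards [ae_all_iff.2 hlin] with ω hω
    ext i
    simp [labels, hω i]
  have hI : ∫ ω, energy (gramResolvent c fun k i => o i (ψ k) ω)
      (labels (fun i => o i f ω) ε fun i => e i ω) ∂P = _ :=
    (integral_congr_ae (hae.mono fun ω hω => by rw [hω]; rfl)).trans
      (integral_noisy_energy (h.hasLaw_features h0 h1) h.memLp_noise h.integral_noise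
        h.integral_noise_mul (h.indepFun_features ψ) hc b ε)
  have A := abs_integral_signal_sub_le (n := Fin N) hc ht b
  have B := abs_integral_frobenius_sub_le (n := Fin N) hc ht
  rw [hI]
  set I1 := ∫ x : κ → Fin N → ℝ, (gramResolvent c x *ᵥ ∑ k, b k • x k) ⬝ᵥ
    (gramResolvent c x *ᵥ ∑ k, b k • x k) ∂gaussFeatures κ (Fin N)
  set I2 := ∫ x : κ → Fin N → ℝ, ∑ i, (gramResolvent c x *ᵥ Pi.single i 1) ⬝ᵥ
    (gramResolvent c x *ᵥ Pi.single i 1) ∂gaussFeatures κ (Fin N)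
  rw [Fintype.card_fin] at A B
  have e1 : ∑ k, b k ^ 2 * ((N : ℝ) / (1 + c k * N) ^ 2) 
      = (N : ℝ) * ∑ k, b k ^ 2 / (1 + c k * N) ^ 2 := by
    rw [Finset.mul_sum]
    exact Finset.sum_congr rfl fun k _ => by ring
  rw [e1] at A
  set Y := ∑ k, b k ^ 2 / (1 + c k * N) ^ 2
  have ht0 : 0 ≤ t := (Finset.sum_nonneg fun k _ => hc k).trans ht
  have hq : 2 * t ≤ errorFactor t := by
    unfold errorFactor
    have h1 := mul_nonneg squareVariance_nonneg ht0
    have h2 := mul_nonneg squareVariance_nonneg (sq_nonneg t)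
    linarith
  have B' : ε ^ 2 * |I2 - N| ≤ ε ^ 2 * (errorFactor t * N) := by
    refine mul_le_mul_of_nonneg_left (B.trans ?_) (sq_nonneg ε)
    gcongr
  calc |I1 + ε ^ 2 * I2 - N * (Y + ε ^ 2)| = |(I1 - N * Y) + ε ^ 2 * (I2 - N)| := by
        congr 1; ring
    _ ≤ |I1 - N * Y| + |ε ^ 2 * (I2 - N)| := abs_add_le _ _
    _ = |I1 - N * Y| + ε ^ 2 * |I2 - N| := by rw [abs_mul, abs_of_nonneg (sq_nonneg ε)]
    _ ≤ errorFactor t * (N * Y) + ε ^ 2 * (errorFactor t * N) := add_le_add A B'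
    _ = _ := by ring

/-- The resolvent of the Gram matrix truncated to the features in `F`, with weights `c`. -/
noncomputable def truncatedResolvent {ι : Type*} (F : Finset ι) (c : ι → ℝ) (φ : ι → C(X, ℝ))
    (o : Fin N → C(X, ℝ) → Ω → ℝ) (ω : Ω) : Matrix (Fin N) (Fin N) ℝ :=
  (1 + weightedGram F c fun k i => o i (φ k) ω)⁻¹

/-- The mean training error, multiplied by `N`, for a kernel of finite rank and arbitrary `f`. The
component of `f` that is orthogonal to the eigenfunctions is one more direction, of weight zero. -/
theorem IsNoisyGaussianSample.abs_integral_truncated_sub_le (hS : IsScalarProduct S)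
    (h : IsNoisyGaussianSample P S o ν e)
    {ι : Type*} {φ : ι → C(X, ℝ)} (h0 : ∀ k l, k ≠ l → S (φ k) (φ l) = 0)
    (h1 : ∀ k, S (φ k) (φ k) = 1) {c : ι → ℝ} (hc : ∀ k, 0 ≤ c k) (F : Finset ι) {t : ℝ}
    (ht : ∑ k ∈ F, c k ≤ t) (ε : ℝ) (f : C(X, ℝ)) :
    |∫ ω, energy (truncatedResolvent F c φ o ω)
          (labels (fun i => o i f ω) ε fun i => e i ω) ∂P
        - N * (∑ k ∈ F, S f (φ k) ^ 2 / (1 + c k * N) ^ 2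
            + (S f f - ∑ k ∈ F, S f (φ k) ^ 2) + ε ^ 2)|
      ≤ errorFactor t * (N * (∑ k ∈ F, S f (φ k) ^ 2 / (1 + c k * N) ^ 2
            + (S f f - ∑ k ∈ F, S f (φ k) ^ 2) + ε ^ 2)) := by
  classical
  set p : C(X, ℝ) := ∑ k ∈ F, S f (φ k) • φ k with hp
  set r : C(X, ℝ) := f - p with hr
  have hpk : ∀ k ∈ F, S p (φ k) = S f (φ k) := fun k hk => by
    rw [hp, map_sum, _root_.sum_apply, Finset.sum_eq_single_of_mem k hk]
    · simp [h1]
    · intro l _ hl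
      simp [h0 l k hl]
  have hrk : ∀ k ∈ F, S r (φ k) = 0 := fun k hk => by
    rw [hr, map_sub, _root_.sub_apply, hpk k hk, sub_self]
  have hfp : S f p = ∑ k ∈ F, S f (φ k) ^ 2 := by
    rw [hp, map_sum]
    exact Finset.sum_congr rfl fun k _ => by rw [map_smul, smul_eq_mul, pow_two]
  have hrp : S r p = 0 := by
    rw [hp, map_sum]
    exact Finset.sum_eq_zero fun k hk => by rw [map_smul, hrk k hk, smul_zero]
  have hrr : S r r = S f f - ∑ k ∈ F, S f (φ k) ^ 2 := by
    have e1 : S r r = S r f := by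
      conv_lhs => rw [hr, map_sub, ← hr, hrp, sub_zero]
    rw [e1, hS.symm, hr, map_sub, hfp]
  rw [← hrr]
  have hgram : ∀ ω, truncatedResolvent F c φ o ω
      = gramResolvent (fun k : F => c k) fun k i => o i (φ k) ω := fun ω => by
    unfold truncatedResolvent gramResolvent weightedGram
    rw [Finset.univ_eq_attach,
      Finset.sum_attach F fun k => Matrix.of fun i j => c k * o i (φ k) ω * o j (φ k) ω]
  have ht' : ∑ k : F, c k ≤ t := by rwa [Finset.sum_coe_sort F c]
  -- The remainder `r` is normalized to serve as a further feature, which requires `r ≠ 0`.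
  by_cases hr0 : r = 0
  · have hf : f = ∑ k : F, S f (φ k) • φ k := by
      rw [Finset.sum_coe_sort F fun k => S f (φ k) • φ k, ← hp]
      exact sub_eq_zero.1 hr0
    have key := h.abs_integral_energy_sub_le (κ := F) (ψ := fun k => φ k)
      (fun k l hkl => h0 k l fun hh => hkl (Subtype.ext hh)) (fun k => h1 k) (fun k => hc k) ht' ε hf
    rw [Finset.sum_coe_sort F fun k => S f (φ k) ^ 2 / (1 + c k * N) ^ 2] at key
    simpa only [hgram, hr0, map_zero, add_zero] using key
  · have hpos : 0 < S r r := hS.pos r hr0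
    set q := Real.sqrt (S r r) with hq
    have hqpos : 0 < q := Real.sqrt_pos.2 hpos
    have hqq : q ^ 2 = S r r := Real.sq_sqrt hpos.le
    let ψ : Option F → C(X, ℝ) := fun k => k.elim (q⁻¹ • r) fun k => φ k
    let c' : Option F → ℝ := fun k => k.elim 0 fun k => c k
    let b : Option F → ℝ := fun k => k.elim q fun k => S f (φ k)
    have hf : f = ∑ k, b k • ψ k := by
      simp only [Fintype.sum_option, b, ψ, Option.elim]
      rw [smul_smul, mul_inv_cancel₀ hqpos.ne', one_smul,
        Finset.sum_coe_sort F fun k => S f (φ k) • φ k, ← hp, hr]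
      abel
    have key := h.abs_integral_energy_sub_le (κ := Option F) (ψ := ψ) (c := c') (b := b) ?_ ?_ ?_
      (t := t) ?_ ε hf
    · have hg : ∀ ω, gramResolvent c' (fun k i => o i (ψ k) ω) = truncatedResolvent F c φ o ω :=
        fun ω => by
          rw [hgram]
          unfold gramResolvent
          congr 2
          ext i j
          simp [weightedGram_apply, Fintype.sum_option, c', ψ]
      simp only [hg] at key
      simp only [Fintype.sum_option, b, c', Option.elim] at key
      rw [Finset.sum_coe_sort F fun k => S f (φ k) ^ 2 / (1 + c k * N) ^ 2, hqq] at key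
      simpa [add_comm (S r r)] using key
    · rintro (_ | k) (_ | l) hkl
      · exact absurd rfl hkl
      · simp [ψ, hrk l l.2]
      · simp [ψ, hS.symm (φ k) r, hrk k k.2]
      · exact h0 k l fun hh => hkl (by rw [Subtype.ext hh])
    · rintro (_ | k)
      · simp only [ψ, Option.elim, map_smul, _root_.smul_apply, smul_eq_mul]
        rw [← hqq]
        field_simp
      · exact h1 k
    · rintro (_ | k)
      · exact le_rfl
      · exact hc k
    · simpa [Fintype.sum_option, c'] using ht'

end Finite

end KernelRidge

namespace KernelRidge

open Matrix Filter Topology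

/-! ### Infinitely many features -/

section Limit

theorem abs_energy_le {n : Type*} [Fintype n] [DecidableEq n] {A : Matrix n n ℝ}
    (hA : A.PosSemidef) (y : n → ℝ) : |energy (1 + A)⁻¹ y| ≤ y ⬝ᵥ y := by
  unfold energy
  rw [abs_of_nonneg (dotProduct_self_nonneg' _)]
  exact resolvent_contraction hA y

/-- The residuals of ridge regression with Gram matrix `N lam A` are `-(1 + A)⁻¹ y`. -/
theorem meanSquare_fittedValues {N : ℕ} (hN : 1 ≤ N) {lam : ℝ} (hlam : 0 < lam)
    {A : Matrix (Fin N) (Fin N) ℝ} (hA : A.PosSemidef) (y : Fin N → ℝ) :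
    meanSquare (fittedValues ((N * lam) • A) lam y) y = 1 / N * energy (1 + A)⁻¹ y := by
  have hN0 : (N : ℝ) ≠ 0 := by positivity
  have hp := resolvent_mulVec_add hA y
  have hdet : IsUnit (1 + A).det := (isUnit_iff_isUnit_det _).1 (isUnit_one_add hA)
  have h1 : (1 / (N : ℝ)) • ((N * lam) • A) = lam • A := by
    rw [smul_smul]
    congr 1
    field_simp
  have h2 : lam • A + lam • (1 : Matrix (Fin N) (Fin N) ℝ) = lam • (1 + A) := by
    rw [smul_add, add_comm]
  have h3 : (lam • (1 + A))⁻¹ = lam⁻¹ • (1 + A)⁻¹ := by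
    refine inv_eq_left_inv ?_
    rw [smul_mul_smul_comm, inv_mul_cancel₀ hlam.ne', one_smul, nonsing_inv_mul _ hdet]
  have h4 : fittedValues ((N * lam) • A) lam y = A *ᵥ ((1 + A)⁻¹ *ᵥ y) := by
    unfold fittedValues ridgeInverse
    rw [h1, h2, h3, smul_mulVec, smul_mulVec, mulVec_smul, smul_smul, mul_inv_cancel₀ hlam.ne',
      one_smul]
  unfold meanSquare energy
  rw [h4]
  congr 1
  refine Finset.sum_congr rfl fun i _ => ?_
  have := congrFun hp i
  rw [Pi.add_apply] at this
  rw [← this]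
  ring

theorem tendsto_energy_resolvent {n β : Type*} [Fintype n] [DecidableEq n] {l : Filter β}
    {A : β → Matrix n n ℝ} {A₀ : Matrix n n ℝ} (hA₀ : A₀.PosSemidef)
    (h : ∀ i j, Tendsto (fun a => A a i j) l (𝓝 (A₀ i j))) (y : n → ℝ) :
    Tendsto (fun a => energy (1 + A a)⁻¹ y) l (𝓝 (energy (1 + A₀)⁻¹ y)) := by
  have h1 : Tendsto A l (𝓝 A₀) := tendsto_pi_nhds.2 fun i => tendsto_pi_nhds.2 fun j => h i j
  have hdet : (1 + A₀).det ≠ 0 := ((isUnit_iff_isUnit_det _).1 (isUnit_one_add hA₀)).ne_zero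
  have hinv : ContinuousAt Ring.inverse (1 + A₀).det := by
    rw [Ring.inverse_eq_inv']
    exact continuousAt_inv₀ hdet
  have h2 : Tendsto (fun a => (1 + A a)⁻¹) l (𝓝 (1 + A₀)⁻¹) :=
    (continuousAt_matrix_inv _ hinv).tendsto.comp (tendsto_const_nhds.add h1)
  have h3 : Continuous fun r : Matrix n n ℝ => energy r y := by
    unfold energy
    fun_prop
  exact (h3.tendsto _).comp h2

theorem posSemidef_of_tendsto {n β : Type*} [Fintype n] {l : Filter β} [l.NeBot]
    {A : β → Matrix n n ℝ} {A₀ : Matrix n n ℝ} (hA : ∀ a, (A a).PosSemidef)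
    (h : ∀ i j, Tendsto (fun a => A a i j) l (𝓝 (A₀ i j))) : A₀.PosSemidef := by
  refine PosSemidef.of_dotProduct_mulVec_nonneg ?_ fun x => ?_
  · ext i j
    refine tendsto_nhds_unique (f := fun a => A a j i) ?_ ?_ (l := l)
    · simpa using h j i
    · have : (fun a => A a j i) = fun a => A a i j := by
        ext a
        simpa using (hA a).isHermitian.apply i j
      rw [this]
      exact h i j
  · refine ge_of_tendsto' (f := fun a => star x ⬝ᵥ A a *ᵥ x) (x := l) ?_
      fun a => (hA a).dotProduct_mulVec_nonneg x
    simp only [dotProduct, mulVec]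
    exact tendsto_finsetSum _ fun i _ => (tendsto_finsetSum _ fun j _ =>
      (h i j).mul_const _).const_mul _

variable {X : Type*} [TopologicalSpace X] {S : C(X, ℝ) →L[ℝ] C(X, ℝ) →L[ℝ] ℝ}

theorem IsScalarProduct.nonneg (hS : IsScalarProduct S) (f : C(X, ℝ)) : 0 ≤ S f f := by
  by_cases h : f = 0
  · simp [h]
  · exact (hS.pos f h).le

/-- Bessel's inequality. -/
theorem IsScalarProduct.sum_sq_le (hS : IsScalarProduct S) {ι : Type*} {φ : ι → C(X, ℝ)}
    (h0 : ∀ k l, k ≠ l → S (φ k) (φ l) = 0) (h1 : ∀ k, S (φ k) (φ k) = 1) (f : C(X, ℝ))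
    (F : Finset ι) : ∑ k ∈ F, S f (φ k) ^ 2 ≤ S f f := by
  classical
  have h := hS.nonneg (f - ∑ k ∈ F, S f (φ k) • φ k)
  have e1 : S f (∑ k ∈ F, S f (φ k) • φ k) = ∑ k ∈ F, S f (φ k) ^ 2 := by
    rw [map_sum]
    exact Finset.sum_congr rfl fun k _ => by rw [map_smul, smul_eq_mul, pow_two]
  have e2 : S (∑ k ∈ F, S f (φ k) • φ k) (∑ k ∈ F, S f (φ k) • φ k)
      = ∑ k ∈ F, S f (φ k) ^ 2 := by
    rw [map_sum]
    refine Finset.sum_congr rfl fun k hk => ?_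
    rw [hS.symm, map_sum, Finset.sum_eq_single_of_mem k hk]
    · simp [h1, pow_two]
    · intro l _ hl
      simp [h0 k l hl.symm]
  simp only [map_sub, _root_.sub_apply, hS.symm (∑ k ∈ F, S f (φ k) • φ k) f, e1, e2] at h
  linarith

theorem IsScalarProduct.summable_sq (hS : IsScalarProduct S) {ι : Type*} {φ : ι → C(X, ℝ)}
    (h0 : ∀ k l, k ≠ l → S (φ k) (φ l) = 0) (h1 : ∀ k, S (φ k) (φ k) = 1) (f : C(X, ℝ)) :
    Summable fun k => S f (φ k) ^ 2 :=
  summable_of_sum_le (fun _ => sq_nonneg _) (hS.sum_sq_le h0 h1 f)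

/-- The risk `∑ₖ ⟨f, fₖ⟩² / (1 + dₖ / θ)²`, plus the squared norm of the component of `f` that is
orthogonal to all `fₖ`, plus the variance of the noise. With the signal capture threshold in the
place of `θ` this is the approximate risk without the factor `∂ϑ`; with the ridge in the place of
`θ` it is a first approximation to the mean training error. -/
noncomputable def ridgeRisk {ι : Type*} (S : C(X, ℝ) →L[ℝ] C(X, ℝ) →L[ℝ] ℝ) (d : ι → ℝ)
    (φ : ι → C(X, ℝ)) (θ ε : ℝ) (f : C(X, ℝ)) : ℝ :=
  ∑' k, S f (φ k) ^ 2 / (1 + d k / θ) ^ 2 + (S f f - ∑' k, S f (φ k) ^ 2) + ε ^ 2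

variable {Ω : Type*} [MeasurableSpace Ω] {P : Measure Ω} {N : ℕ} {o : Fin N → C(X, ℝ) → Ω → ℝ}
  {ν : Measure ℝ} {e : Fin N → Ω → ℝ}

theorem IsNoisyGaussianSample.ae_summable (h : IsNoisyGaussianSample P S o ν e)
    {ι : Type*} [Countable ι] {φ : ι → C(X, ℝ)} (h1 : ∀ k, S (φ k) (φ k) = 1) {c : ι → ℝ}
    (hc : ∀ k, 0 ≤ c k) (hcs : Summable c) (i : Fin N) :
    ∀ᵐ ω ∂P, Summable fun k => c k * o i (φ k) ω ^ 2 := by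
  have hint : ∀ k, Integrable (fun ω => c k * o i (φ k) ω ^ 2) P := fun k =>
    (h.memLp_obs i (φ k)).integrable_sq.const_mul _
  have hnn : ∀ k ω, 0 ≤ c k * o i (φ k) ω ^ 2 := fun k ω => mul_nonneg (hc k) (sq_nonneg _)
  have hval : ∀ k, ∫ ω, ‖c k * o i (φ k) ω ^ 2‖ ∂P = c k := fun k => by
    have := h.obs_second_moment i (φ k) (φ k)
    rw [h1] at this
    simp only [Real.norm_of_nonneg (hnn k _)]
    rw [integral_const_mul]
    simp only [pow_two, this, mul_one]
  have hne : ∑' k, eLpNorm (fun ω => c k * o i (φ k) ω ^ 2) 1 P ≠ ⊤ := by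
    have : ∀ k, eLpNorm (fun ω => c k * o i (φ k) ω ^ 2) 1 P = ENNReal.ofReal (c k) := fun k => by
      rw [eLpNorm_one_eq_lintegral_enorm, ← ofReal_integral_norm_eq_lintegral_enorm (hint k), hval]
    simp only [this]
    exact hcs.tsum_ofReal_ne_top
  filter_upwards [summable_norm_of_tsum_eLpNorm_ne_top le_rfl
    (fun k => (hint k).aestronglyMeasurable) hne] with ω hω
  simpa only [Real.norm_of_nonneg (hnn _ ω)] using hω

variable [IsProbabilityMeasure P]

/-- The mean training error, up to a relative error that is controlled by
`Tr[T_K] / (lam N) = ∑ₖ dₖ / (lam N)`: the limit of the case of finitely many features. -/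
theorem IsNoisyGaussianSample.abs_integral_spectralTrainingRisk_sub_le (hS : IsScalarProduct S)
    (h : IsNoisyGaussianSample P S o ν e) {ι : Type*} [Countable ι] {φ : ι → C(X, ℝ)}
    (h0 : ∀ k l, k ≠ l → S (φ k) (φ l) = 0) (h1 : ∀ k, S (φ k) (φ k) = 1) {d : ι → ℝ}
    (hd : ∀ k, 0 ≤ d k) (hds : Summable d) (hN : 1 ≤ N) {lam : ℝ} (hlam : 0 < lam) (ε : ℝ)
    (f : C(X, ℝ)) :
    Integrable (fun ω => spectralTrainingRisk d lam ε
        (fun i => o i f ω) (fun i k => o i (φ k) ω) (fun i => e i ω)) P ∧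
      |∫ ω, spectralTrainingRisk d lam ε
          (fun i => o i f ω) (fun i k => o i (φ k) ω) (fun i => e i ω) ∂P
          - ridgeRisk S d φ lam ε f|
        ≤ errorFactor ((∑' k, d k) / (lam * N)) * ridgeRisk S d φ lam ε f := by
  classical
  have hN0 : (0 : ℝ) < N := by positivity
  have hM : (0 : ℝ) < N * lam := by positivity
  set c : ι → ℝ := fun k => (N * lam)⁻¹ * d k with hc
  have hc0 : ∀ k, 0 ≤ c k := fun k => mul_nonneg (by positivity) (hd k)
  have hcs : Summable c := hds.mul_left _
  have hcN : ∀ k, c k * N = d k / lam := fun k => by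
    simp only [hc]; field_simp
  set y : Ω → Fin N → ℝ := fun ω => labels (fun i => o i f ω) ε fun i => e i ω with hy
  set A : Ω → Matrix (Fin N) (Fin N) ℝ := fun ω =>
    Matrix.of fun i j => ∑' k, c k * o i (φ k) ω * o j (φ k) ω with hA
  -- the truncated Gram matrices converge almost surely
  have hlimA : ∀ᵐ ω ∂P, ∀ i j, Tendsto
      (fun F : Finset ι => weightedGram F c (fun k i => o i (φ k) ω) i j) atTop (𝓝 (A ω i j)) := by
    filter_upwards [ae_all_iff.2 fun i => h.ae_summable h1 hc0 hcs i] with ω hω i j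
    simp only [weightedGram_apply, hA, of_apply]
    refine Summable.hasSum (Summable.of_norm_bounded ((hω i).add (hω j)) fun k => ?_)
    have hk := hc0 k
    rw [Real.norm_eq_abs, mul_assoc, abs_mul, abs_of_nonneg hk, ← mul_add]
    refine mul_le_mul_of_nonneg_left (abs_le.2 ⟨?_, ?_⟩) hk <;>
      nlinarith [sq_nonneg (o i (φ k) ω + o j (φ k) ω), sq_nonneg (o i (φ k) ω - o j (φ k) ω)]
  have hpos : ∀ᵐ ω ∂P, (A ω).PosSemidef := hlimA.mono fun ω hω =>
    posSemidef_of_tendsto (fun F => posSemidef_weightedGram F hc0 _) hω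
  have hlim : ∀ᵐ ω ∂P, Tendsto
      (fun F : Finset ι => energy (truncatedResolvent F c φ o ω) (y ω)) atTop
      (𝓝 (energy (1 + A ω)⁻¹ (y ω))) := by
    filter_upwards [hlimA, hpos] with ω h2 h3
    exact tendsto_energy_resolvent h3 h2 (y ω)
  -- the energies are dominated by the squared norm of the labels
  have hyL : ∀ i, MemLp (fun ω => y ω i) 2 P := fun i =>
    (h.memLp_obs i f).add ((h.memLp_noise i).const_mul ε)
  have hyint : Integrable (fun ω => y ω ⬝ᵥ y ω) P :=
    integrable_finsetSum _ fun i _ => (hyL i).integrable_mul (hyL i)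
  have hmeas : ∀ F : Finset ι,
      AEStronglyMeasurable (fun ω => energy (truncatedResolvent F c φ o ω) (y ω)) P := fun F => by
    have hZ : AEMeasurable (fun ω (k : F) (i : Fin N) => o i (φ k) ω) P :=
      aemeasurable_pi_lambda _ fun k => aemeasurable_pi_lambda _ fun i =>
        (h.memLp_obs i (φ k)).aestronglyMeasurable.aemeasurable
    have hR : ∀ i j, AEMeasurable (fun ω => truncatedResolvent F c φ o ω i j) P := fun i j => by
      have := (measurable_gramResolvent_apply (n := Fin N) (fun k : F => c k) i j).comp_aemeasurable
        hZ
      convert this using 2 with ω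
      simp only [truncatedResolvent, gramResolvent, weightedGram, Function.comp,
        Finset.univ_eq_attach,
        Finset.sum_attach F fun k => Matrix.of fun i j => c k * o i (φ k) ω * o j (φ k) ω]
    have hyM : ∀ i, AEMeasurable (fun ω => y ω i) P := fun i =>
      (hyL i).aestronglyMeasurable.aemeasurable
    simp only [energy, dotProduct, mulVec]
    refine AEMeasurable.aestronglyMeasurable ?_
    fun_prop
  have hbound : ∀ F : Finset ι, ∀ᵐ ω ∂P,
      ‖energy (truncatedResolvent F c φ o ω) (y ω)‖ ≤ y ω ⬝ᵥ y ω := fun F =>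
    .of_forall fun ω => abs_energy_le (posSemidef_weightedGram F hc0 _) (y ω)
  have hconv := tendsto_integral_filter_of_dominated_convergence (fun ω => y ω ⬝ᵥ y ω)
    (.of_forall hmeas) (.of_forall hbound) hyint hlim
  have hint : Integrable (fun ω => energy (1 + A ω)⁻¹ (y ω)) P := by
    refine hyint.mono' (aestronglyMeasurable_of_tendsto_ae atTop hmeas hlim) ?_
    filter_upwards [hpos] with ω hω
    exact abs_energy_le hω (y ω)
  have hrisk : ∀ᵐ ω ∂P, spectralTrainingRisk d lam ε
      (fun i => o i f ω) (fun i k => o i (φ k) ω) (fun i => e i ω)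
      = 1 / N * energy (1 + A ω)⁻¹ (y ω) := by
    filter_upwards [hpos] with ω hω
    rw [← meanSquare_fittedValues hN hlam hω]
    unfold spectralTrainingRisk
    congr 2
    ext i j
    simp only [spectralGram, hA, hc, of_apply, Matrix.smul_apply, smul_eq_mul, mul_assoc]
    rw [tsum_mul_left]
    field_simp
  refine ⟨(hint.const_mul _).congr (hrisk.mono fun ω hω => hω.symm), ?_⟩
  rw [integral_congr_ae hrisk, integral_const_mul]
  -- the bound for finitely many features passes to the limit
  have hb := hS.summable_sq h0 h1 f
  have hb' : Summable fun k => S f (φ k) ^ 2 / (1 + d k / lam) ^ 2 := by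
    refine Summable.of_nonneg_of_le (fun k => by positivity) (fun k => ?_) hb
    refine div_le_self (sq_nonneg _) (one_le_pow₀ ?_)
    have := div_nonneg (hd k) hlam.le
    linarith
  set t := (∑' k, d k) / (lam * N) with ht
  have htc : ∀ F : Finset ι, ∑ k ∈ F, c k ≤ t := fun F => by
    have : t = ∑' k, c k := by
      simp only [hc]
      rw [tsum_mul_left, ht]
      field_simp
    rw [this]
    exact hcs.sum_le_tsum F fun k _ => hc0 k
  have key : ∀ F : Finset ι, _ := fun F =>
    h.abs_integral_truncated_sub_le hS h0 h1 hc0 F (htc F) ε f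
  simp only [hcN] at key
  have a1 : Tendsto (fun F : Finset ι => ∑ k ∈ F, S f (φ k) ^ 2 / (1 + d k / lam) ^ 2) atTop
      (𝓝 (∑' k, S f (φ k) ^ 2 / (1 + d k / lam) ^ 2)) := hb'.hasSum
  have a2 : Tendsto (fun F : Finset ι => ∑ k ∈ F, S f (φ k) ^ 2) atTop
      (𝓝 (∑' k, S f (φ k) ^ 2)) := hb.hasSum
  have hD : Tendsto (fun F : Finset ι => (N : ℝ) * (∑ k ∈ F, S f (φ k) ^ 2 / (1 + d k / lam) ^ 2
      + (S f f - ∑ k ∈ F, S f (φ k) ^ 2) + ε ^ 2)) atTop (𝓝 (N * ridgeRisk S d φ lam ε f)) :=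
    ((a1.add (tendsto_const_nhds.sub a2)).add tendsto_const_nhds).const_mul _
  have fin := le_of_tendsto_of_tendsto' (hconv.sub hD).abs (hD.const_mul (errorFactor t)) key
  set I := ∫ ω, energy (1 + A ω)⁻¹ (y ω) ∂P
  set D := ridgeRisk S d φ lam ε f
  have e1 : 1 / (N : ℝ) * I - D = (I - N * D) / N := by field_simp
  rw [e1, abs_div, abs_of_pos hN0, div_le_iff₀ hN0]
  linarith

end Limit

end KernelRidge

namespace KernelRidge

open Filter Topology

/-! ### The integral operator -/

section Operator

variable {X : Type*} [TopologicalSpace X]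
  {S : C(X, ℝ) →L[ℝ] C(X, ℝ) →L[ℝ] ℝ} {K : C(X × X, ℝ)} {ι : Type*} {d : ι → ℝ}
  {φ : ι → C(X, ℝ)}

theorem IsDiagonalization.coeff_hasSum (hK : IsDiagonalization K S d φ) (hS : IsScalarProduct S)
    {a : ι → ℝ} {w : C(X, ℝ)} (hw : HasSum (fun k => a k • φ k) w) (k : ι) : S w (φ k) = a k := by
  have h : HasSum (fun l => a l * S (φ k) (φ l)) (S (φ k) w) := by
    simpa using hw.mapL (S (φ k))
  rw [hS.symm]
  refine h.unique ?_
  have := hasSum_single (f := fun l => a l * S (φ k) (φ l)) k fun l hl => by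
    simp [hK.orthogonal k l hl.symm]
  simpa [hK.normalized] using this

variable [CompactSpace X]

theorem IsDiagonalization.sum_sq_le (hK : IsDiagonalization K S d φ) (F : Finset ι) (x : X) :
    ∑ k ∈ F, d k * φ k x ^ 2 ≤ ‖K‖ := by
  have h : HasSum (fun k => d k * φ k x ^ 2) (K (x, x)) := by
    have := hK.hasSum.mapL (ContinuousMap.evalCLM ℝ (x, x))
    simpa [tensor, pow_two] using this
  exact (sum_le_hasSum F (fun k _ => mul_nonneg (hK.nonneg k) (sq_nonneg _)) h).trans
    ((le_abs_self _).trans (K.norm_coe_le_norm (x, x)))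

/-- A series `∑ₖ dₖ βₖ fₖ` converges uniformly if `∑ₖ dₖ βₖ²` is finite. This follows from the
Cauchy–Schwarz inequality, as `∑ₖ dₖ fₖ(x)²` is bounded. -/
theorem IsDiagonalization.summable_smul (hK : IsDiagonalization K S d φ) {β : ι → ℝ}
    (hβ : Summable fun k => d k * β k ^ 2) : Summable fun k => (d k * β k) • φ k := by
  rw [summable_iff_vanishing_norm]
  intro η hη
  obtain ⟨s, hs⟩ := summable_iff_vanishing_norm.1 hβ (η ^ 2 / (‖K‖ + 1)) (by positivity)
  refine ⟨s, fun t ht => ?_⟩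
  have h1 := (le_abs_self _).trans_lt (hs t ht)
  rw [ContinuousMap.norm_lt_iff _ hη]
  intro x
  have h2 : (∑ k ∈ t, d k * β k * φ k x) ^ 2
      ≤ (∑ k ∈ t, d k * β k ^ 2) * ∑ k ∈ t, d k * φ k x ^ 2 :=
    Finset.sum_sq_le_sum_mul_sum_of_sq_le_mul t
      (fun k _ => mul_nonneg (hK.nonneg k) (sq_nonneg _))
      (fun k _ => mul_nonneg (hK.nonneg k) (sq_nonneg _)) fun k _ => le_of_eq (by ring)
  have h3 := hK.sum_sq_le t x
  have h4 : 0 ≤ ∑ k ∈ t, d k * β k ^ 2 :=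
    Finset.sum_nonneg fun k _ => mul_nonneg (hK.nonneg k) (sq_nonneg _)
  have h5 : (∑ k ∈ t, d k * β k * φ k x) ^ 2 < η ^ 2 :=
    calc _ ≤ (∑ k ∈ t, d k * β k ^ 2) * (‖K‖ + 1) := h2.trans (by gcongr; linarith)
      _ < η ^ 2 / (‖K‖ + 1) * (‖K‖ + 1) := by gcongr
      _ = η ^ 2 := by field_simp
  have h6 := abs_lt_of_sq_lt_sq h5 hη.le
  simpa using h6

variable [T2Space X]

theorem continuous_kernelMap (μ : C(X, ℝ) →L[ℝ] ℝ) :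
    Continuous fun K : C(X × X, ℝ) => kernelMap K μ :=
  (ContinuousMap.continuous_postcomp (⟨μ, μ.continuous⟩ : C(C(X, ℝ), ℝ))).comp
    ContinuousMap.continuous_curry

/-- `K μ = ∑ₖ dₖ μ(fₖ) fₖ`, uniformly convergent. -/
theorem IsDiagonalization.hasSum_kernelMap (hK : IsDiagonalization K S d φ)
    (μ : C(X, ℝ) →L[ℝ] ℝ) : HasSum (fun k => (d k * μ (φ k)) • φ k) (kernelMap K μ) := by
  let T : C(X × X, ℝ) →+ C(X, ℝ) :=
    { toFun := fun K => kernelMap K μ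
      map_zero' := by
        ext x
        exact map_zero μ
      map_add' := fun K L => by
        ext x
        exact map_add μ (K.curry x) (L.curry x) }
  have h := hK.hasSum.map T (continuous_kernelMap μ)
  change HasSum _ (T K)
  convert h using 2 with k
  ext x
  have e : (d k • tensor (φ k) (φ k)).curry x = (d k * φ k x) • φ k := by
    ext x'
    simp [tensor, mul_assoc]
  change d k * μ (φ k) * φ k x = μ ((d k • tensor (φ k) (φ k)).curry x)
  rw [e, map_smul, smul_eq_mul]
  ring

theorem IsDiagonalization.hasSum_integralOperator (hK : IsDiagonalization K S d φ) (f : C(X, ℝ)) :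
    HasSum (fun k => (d k * S f (φ k)) • φ k) (integralOperator K S f) :=
  hK.hasSum_kernelMap (S f)

theorem IsDiagonalization.hasSum_scalarProduct (hK : IsDiagonalization K S d φ) (f g : C(X, ℝ)) :
    HasSum (fun k => d k * S f (φ k) * S g (φ k)) (S g (integralOperator K S f)) := by
  simpa using (hK.hasSum_integralOperator f).mapL (S g)

theorem IsDiagonalization.coeff_integralOperator (hK : IsDiagonalization K S d φ)
    (hS : IsScalarProduct S) (f : C(X, ℝ)) (k : ι) :
    S (integralOperator K S f) (φ k) = d k * S f (φ k) :=
  hK.coeff_hasSum hS (hK.hasSum_integralOperator f) k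

theorem IsDiagonalization.injective_add_smul (hK : IsDiagonalization K S d φ)
    (hS : IsScalarProduct S) {θ : ℝ} (hθ : 0 < θ) {h : C(X, ℝ)}
    (h0 : integralOperator K S h + θ • h = 0) : h = 0 := by
  by_contra hne
  have h1 : 0 ≤ S h (integralOperator K S h) := by
    refine (hK.hasSum_scalarProduct h h).nonneg fun k => ?_
    rw [mul_assoc]
    exact mul_nonneg (hK.nonneg k) (mul_self_nonneg _)
  have h2 : S h (integralOperator K S h + θ • h) = 0 := by rw [h0, map_zero]
  rw [map_add, map_smul, smul_eq_mul] at h2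
  have h3 := mul_pos hθ (hS.pos h hne)
  linarith

theorem IsDiagonalization.exists_add_smul_eq (hK : IsDiagonalization K S d φ)
    (hS : IsScalarProduct S) {θ : ℝ} (hθ : 0 < θ) (f : C(X, ℝ)) :
    ∃ h, integralOperator K S h + θ • h = f := by
  have hpos : ∀ k, 0 < d k + θ := fun k => add_pos_of_nonneg_of_pos (hK.nonneg k) hθ
  have hsum : Summable fun k => (d k * (S f (φ k) / (d k + θ))) • φ k := by
    refine hK.summable_smul ?_
    refine Summable.of_nonneg_of_le (fun k => mul_nonneg (hK.nonneg k) (sq_nonneg _))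
      (fun k => ?_) ((hS.summable_sq hK.orthogonal hK.normalized f).mul_left θ⁻¹)
    have h1 : d k / (d k + θ) ^ 2 ≤ θ⁻¹ := by
      rw [inv_eq_one_div, div_le_div_iff₀ (pow_pos (hpos k) 2) hθ]
      nlinarith [hK.nonneg k]
    calc d k * (S f (φ k) / (d k + θ)) ^ 2 = d k / (d k + θ) ^ 2 * S f (φ k) ^ 2 := by
          rw [div_pow]; ring
      _ ≤ _ := by gcongr
  obtain ⟨w, hw⟩ := hsum
  -- Here `w = ∑ₖ dₖ / (dₖ + θ) ⟨f, φₖ⟩ φₖ` is `T (T + θ)⁻¹ f`, and `(T + θ)⁻¹ f = θ⁻¹ (f - w)`.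
  refine ⟨θ⁻¹ • (f - w), ?_⟩
  have hT : integralOperator K S (θ⁻¹ • (f - w)) = w := by
    refine (hK.hasSum_integralOperator _).unique ?_
    convert hw using 3 with k
    rw [map_smul, _root_.smul_apply, map_sub, _root_.sub_apply, hK.coeff_hasSum hS hw, smul_eq_mul]
    have := (hpos k).ne'
    field_simp
    ring
  rw [hT, smul_smul, mul_inv_cancel₀ hθ.ne', one_smul]
  abel

theorem IsDiagonalization.isUnit_add_smul (hK : IsDiagonalization K S d φ)
    (hS : IsScalarProduct S) {θ : ℝ} (hθ : 0 < θ) :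
    IsUnit (integralOperator K S + θ • (1 : Module.End ℝ C(X, ℝ))) := by
  rw [Module.End.isUnit_iff]
  refine ⟨?_, fun f => ?_⟩
  · rw [← LinearMap.ker_eq_bot, LinearMap.ker_eq_bot']
    exact fun h h0 => hK.injective_add_smul hS hθ (by simpa using h0)
  · obtain ⟨h, hh⟩ := hK.exists_add_smul_eq hS hθ f
    exact ⟨h, by simpa using hh⟩

/-- `T (T + θ)⁻¹ f = T h` for the solution `h` of `(T + θ) h = f`, whose coefficients are
explicit. -/
theorem IsDiagonalization.exists_reconstruction_eq (hK : IsDiagonalization K S d φ)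
    (hS : IsScalarProduct S) {θ : ℝ} (hθ : 0 < θ) (f : C(X, ℝ)) :
    ∃ h, reconstruction (integralOperator K S) θ f = integralOperator K S h ∧
      integralOperator K S h + θ • h = f ∧ ∀ k, S h (φ k) = S f (φ k) / (d k + θ) := by
  set T := integralOperator K S
  have hu := hK.isUnit_add_smul hS hθ
  refine ⟨Ring.inverse (T + θ • (1 : Module.End ℝ C(X, ℝ))) f, rfl, ?_⟩
  have h1 := congrArg (fun M : Module.End ℝ C(X, ℝ) => M f) (Ring.mul_inverse_cancel _ hu)
  set h := Ring.inverse (T + θ • (1 : Module.End ℝ C(X, ℝ))) f with hh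
  have h2 : T h + θ • h = f := by simpa [← hh] using h1
  refine ⟨h2, fun k => ?_⟩
  have hpos : 0 < d k + θ := add_pos_of_nonneg_of_pos (hK.nonneg k) hθ
  rw [eq_div_iff hpos.ne']
  conv_rhs => rw [← h2]
  rw [map_add, map_smul, _root_.add_apply, _root_.smul_apply, hK.coeff_integralOperator hS,
    smul_eq_mul]
  ring

theorem IsDiagonalization.opTrace_integralOperator (hK : IsDiagonalization K S d φ)
    (hS : IsScalarProduct S) : opTrace S φ (integralOperator K S) = ∑' k, d k := by
  unfold opTrace
  congr 1 with k
  rw [hS.symm, hK.coeff_integralOperator hS, hK.normalized, mul_one]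

theorem IsDiagonalization.opTrace_reconstruction (hK : IsDiagonalization K S d φ)
    (hS : IsScalarProduct S) {θ : ℝ} (hθ : 0 < θ) :
    opTrace S φ (reconstruction (integralOperator K S) θ) = ∑' k, d k / (d k + θ) := by
  unfold opTrace
  congr 1 with k
  obtain ⟨h, e1, -, e3⟩ := hK.exists_reconstruction_eq hS hθ (φ k)
  rw [e1, hS.symm, hK.coeff_integralOperator hS, e3, hK.normalized, mul_one_div]

/-- The squared norm of `(1 - T (T + θ)⁻¹) f`. The last bracket is the squared norm of the component
of `f` that is orthogonal to all eigenfunctions. -/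
theorem IsDiagonalization.norm_sq_sub_reconstruction (hK : IsDiagonalization K S d φ)
    (hS : IsScalarProduct S) {θ : ℝ} (hθ : 0 < θ) (f : C(X, ℝ)) :
    S (f - reconstruction (integralOperator K S) θ f)
        (f - reconstruction (integralOperator K S) θ f)
      = ∑' k, S f (φ k) ^ 2 / (1 + d k / θ) ^ 2 + (S f f - ∑' k, S f (φ k) ^ 2) := by
  obtain ⟨h, e1, e2, e3⟩ := hK.exists_reconstruction_eq hS hθ f
  set T := integralOperator K S
  have hpos : ∀ k, 0 < d k + θ := fun k => add_pos_of_nonneg_of_pos (hK.nonneg k) hθ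
  have hr : f - reconstruction T θ f = θ • h := by
    rw [e1, ← e2]; abel
  have hTh : HasSum (fun k => d k * (S f (φ k) / (d k + θ)) ^ 2) (S h (T h)) := by
    simpa only [e3, mul_assoc, ← pow_two] using hK.hasSum_scalarProduct h h
  have hTT : HasSum (fun k => d k ^ 2 * (S f (φ k) / (d k + θ)) ^ 2) (S (T h) (T h)) := by
    convert hK.hasSum_scalarProduct h (T h) using 2 with k
    rw [hK.coeff_integralOperator hS, e3]
    ring
  have hff : S f f = S (T h) (T h) + 2 * θ * S h (T h) + θ ^ 2 * S h h := by
    conv_lhs => rw [← e2]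
    simp only [map_add, map_smul, _root_.add_apply, _root_.smul_apply, smul_eq_mul,
      hS.symm (T h) h]
    ring
  have hb := (hS.summable_sq hK.orthogonal hK.normalized f).hasSum
  have hsum := hb.sub (hTT.add (hTh.mul_left (2 * θ)))
  have hval : (fun k => S f (φ k) ^ 2 - (d k ^ 2 * (S f (φ k) / (d k + θ)) ^ 2
      + 2 * θ * (d k * (S f (φ k) / (d k + θ)) ^ 2)))
      = fun k => S f (φ k) ^ 2 / (1 + d k / θ) ^ 2 := by
    ext k
    have h1 := (hpos k).ne'
    have h2 : 1 + d k / θ = (d k + θ) / θ := by field_simp; ring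
    rw [h2]
    field_simp
    ring
  rw [hval] at hsum
  rw [hsum.tsum_eq, hr, map_smul, map_smul, _root_.smul_apply, smul_eq_mul, smul_eq_mul, hff]
  ring

end Operator

end KernelRidge

namespace KernelRidge

open Filter Topology

/-! ### The signal capture threshold -/

section Threshold

variable {ι : Type*} {d : ι → ℝ} {N : ℕ}

/-- The threshold equation in terms of the eigenvalues. -/
def IsSpectralThreshold (d : ι → ℝ) (N : ℕ) (lam θ : ℝ) : Prop :=
  0 < θ ∧ θ = lam + θ / N * ∑' k, d k / (d k + θ)

theorem div_add_le_one {x θ : ℝ} (hx : 0 ≤ x) (hθ : 0 < θ) : x / (x + θ) ≤ 1 := by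
  rw [div_le_one (by linarith)]
  linarith

theorem div_add_le_div {x a θ : ℝ} (hx : 0 ≤ x) (ha : 0 < a) (h : a ≤ θ) :
    x / (x + θ) ≤ x / a :=
  div_le_div_of_nonneg_left hx ha (by linarith)

theorem summable_div_add (hd : ∀ k, 0 ≤ d k) (hs : Summable d) {θ : ℝ} (hθ : 0 < θ) :
    Summable fun k => d k / (d k + θ) :=
  Summable.of_nonneg_of_le (fun k => div_nonneg (hd k) (add_nonneg (hd k) hθ.le))
    (fun k => div_add_le_div (hd k) hθ le_rfl) (hs.div_const θ)

theorem mul_tsum_div_add_le (hd : ∀ k, 0 ≤ d k) (hs : Summable d) {θ : ℝ} (hθ : 0 < θ) :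
    θ * ∑' k, d k / (d k + θ) ≤ ∑' k, d k := by
  rw [← tsum_mul_left]
  refine ((summable_div_add hd hs hθ).mul_left θ).tsum_le_tsum (fun k => ?_) hs
  have h := hd k
  rw [mul_div_assoc', div_le_iff₀ (by linarith)]
  nlinarith

theorem tsum_div_add_nonneg (hd : ∀ k, 0 ≤ d k) {θ : ℝ} (hθ : 0 < θ) :
    0 ≤ ∑' k, d k / (d k + θ) :=
  tsum_nonneg fun k => div_nonneg (hd k) (add_nonneg (hd k) hθ.le)

theorem IsSpectralThreshold.le (hd : ∀ k, 0 ≤ d k) {lam θ : ℝ}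
    (h : IsSpectralThreshold d N lam θ) : lam ≤ θ := by
  have h1 : 0 ≤ θ / N * ∑' k, d k / (d k + θ) :=
    mul_nonneg (div_nonneg h.1.le (Nat.cast_nonneg N)) (tsum_div_add_nonneg hd h.1)
  linarith [h.2]

theorem IsSpectralThreshold.le_add (hd : ∀ k, 0 ≤ d k) (hs : Summable d) {lam θ : ℝ}
    (h : IsSpectralThreshold d N lam θ) : θ ≤ lam + (∑' k, d k) / N := by
  have h1 : θ / N * ∑' k, d k / (d k + θ) ≤ (∑' k, d k) / N := by
    rw [div_mul_eq_mul_div]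
    exact div_le_div_of_nonneg_right (mul_tsum_div_add_le hd hs h.1) (Nat.cast_nonneg N)
  linarith [h.2]

theorem exists_isSpectralThreshold (hd : ∀ k, 0 ≤ d k) (hs : Summable d) (hN : 1 ≤ N)
    {lam : ℝ} (hlam : 0 < lam) : ∃ θ, IsSpectralThreshold d N lam θ := by
  have hN0 : (0 : ℝ) < N := by positivity
  have hTr : 0 ≤ (∑' k, d k) / N := div_nonneg (tsum_nonneg hd) hN0.le
  set M := lam + (∑' k, d k) / N with hM
  have hMpos : 0 < M := by linarith
  have hcont : ContinuousOn (fun θ => θ - θ / N * ∑' k, d k / (d k + θ)) (Set.Icc lam M) := by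
    have h1 : ContinuousOn (fun θ => ∑' k, d k / (d k + θ)) (Set.Icc lam M) := by
      refine continuousOn_tsum (u := fun k => d k / lam) (fun k => ?_) (hs.div_const lam)
        fun k θ hθ => ?_
      · refine continuousOn_const.div (by fun_prop) fun θ hθ => ?_
        have := hd k
        have := hθ.1
        linarith
      · have h0 : 0 ≤ d k / (d k + θ) :=
          div_nonneg (hd k) (by linarith [hd k, hθ.1])
        rw [Real.norm_of_nonneg h0]
        exact div_add_le_div (hd k) hlam hθ.1
    fun_prop
  have hivt := intermediate_value_Icc (by linarith : lam ≤ M) hcont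
  have hmem : lam ∈ Set.Icc (lam - lam / N * ∑' k, d k / (d k + lam))
      (M - M / N * ∑' k, d k / (d k + M)) := by
    constructor
    · have : 0 ≤ lam / N * ∑' k, d k / (d k + lam) :=
        mul_nonneg (by positivity) (tsum_div_add_nonneg hd hlam)
      linarith
    · have : M / N * ∑' k, d k / (d k + M) ≤ (∑' k, d k) / N := by
        rw [div_mul_eq_mul_div]
        exact div_le_div_of_nonneg_right (mul_tsum_div_add_le hd hs hMpos) hN0.le
      linarith
  obtain ⟨θ, hθ, he⟩ := hivt hmem
  exact ⟨θ, hlam.trans_le hθ.1, by linarith⟩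

theorem summable_sq_div (hd : ∀ k, 0 ≤ d k) (hs : Summable d) {θ₁ θ₂ : ℝ} (h₁ : 0 < θ₁)
    (h₂ : 0 < θ₂) : Summable fun k => d k ^ 2 / ((d k + θ₁) * (d k + θ₂)) := by
  refine Summable.of_nonneg_of_le (fun k => ?_) (fun k => ?_) (summable_div_add hd hs h₂)
  · have := hd k
    positivity
  · have h := hd k
    rw [pow_two, mul_div_mul_comm]
    exact mul_le_of_le_one_left (by positivity) (div_add_le_one h h₁)

/-- The reciprocal of the difference quotient of the threshold between solutions `θ₁` and `θ₂`. -/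
noncomputable def inverseSlope (d : ι → ℝ) (N : ℕ) (θ₁ θ₂ : ℝ) : ℝ :=
  1 - (∑' k, d k ^ 2 / ((d k + θ₁) * (d k + θ₂))) / N

theorem IsSpectralThreshold.sub_mul_inverseSlope (hd : ∀ k, 0 ≤ d k) (hs : Summable d)
    {l₁ l₂ θ₁ θ₂ : ℝ} (h₁ : IsSpectralThreshold d N l₁ θ₁) (h₂ : IsSpectralThreshold d N l₂ θ₂) :
    (θ₁ - θ₂) * inverseSlope d N θ₁ θ₂ = l₁ - l₂ := by
  have e : θ₁ * ∑' k, d k / (d k + θ₁) - θ₂ * ∑' k, d k / (d k + θ₂)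
      = (θ₁ - θ₂) * ∑' k, d k ^ 2 / ((d k + θ₁) * (d k + θ₂)) := by
    rw [← tsum_mul_left, ← tsum_mul_left, ← tsum_mul_left,
      ← ((summable_div_add hd hs h₁.1).mul_left θ₁).tsum_sub
        ((summable_div_add hd hs h₂.1).mul_left θ₂)]
    congr 1 with k
    have a1 : d k + θ₁ ≠ 0 := (add_pos_of_nonneg_of_pos (hd k) h₁.1).ne'
    have a2 : d k + θ₂ ≠ 0 := (add_pos_of_nonneg_of_pos (hd k) h₂.1).ne'
    field_simp
    ring
  have e1 := h₁.2
  have e2 := h₂.2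
  rw [div_mul_eq_mul_div] at e1 e2
  have e3 : (θ₁ - θ₂) * ((∑' k, d k ^ 2 / ((d k + θ₁) * (d k + θ₂))) / N)
      = θ₁ * (∑' k, d k / (d k + θ₁)) / N - θ₂ * (∑' k, d k / (d k + θ₂)) / N := by
    rw [← sub_div, e, mul_div_assoc]
  unfold inverseSlope
  rw [mul_sub, mul_one, e3]
  linarith

theorem IsSpectralThreshold.le_inverseSlope (hd : ∀ k, 0 ≤ d k) (hs : Summable d)
    {l₂ θ₁ θ₂ : ℝ} (h₁ : 0 < θ₁) (h₂ : IsSpectralThreshold d N l₂ θ₂) :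
    l₂ / θ₂ ≤ inverseSlope d N θ₁ θ₂ := by
  have hle : ∑' k, d k ^ 2 / ((d k + θ₁) * (d k + θ₂)) ≤ ∑' k, d k / (d k + θ₂) := by
    refine (summable_sq_div hd hs h₁ h₂.1).tsum_le_tsum (fun k => ?_) (summable_div_add hd hs h₂.1)
    rw [pow_two, mul_div_mul_comm]
    exact mul_le_of_le_one_left (div_nonneg (hd k) (add_nonneg (hd k) h₂.1.le))
      (div_add_le_one (hd k) h₁)
  have h3 := div_le_div_of_nonneg_right hle (Nat.cast_nonneg (α := ℝ) N)
  have e2 := h₂.2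
  rw [div_mul_eq_mul_div] at e2
  have e3 : (∑' k, d k / (d k + θ₂)) / N = 1 - l₂ / θ₂ := by
    have := h₂.1.ne'
    rw [eq_sub_iff_add_eq, ← mul_left_inj' this, add_mul, div_mul_cancel₀ _ this, one_mul]
    linear_combination -e2
  unfold inverseSlope
  linarith

theorem inverseSlope_le_one (hd : ∀ k, 0 ≤ d k) {θ₁ θ₂ : ℝ} (h₁ : 0 < θ₁) (h₂ : 0 < θ₂) :
    inverseSlope d N θ₁ θ₂ ≤ 1 := by
  have : 0 ≤ (∑' k, d k ^ 2 / ((d k + θ₁) * (d k + θ₂))) / N :=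
    div_nonneg (tsum_nonneg fun k => by have := hd k; positivity) (Nat.cast_nonneg N)
  unfold inverseSlope
  linarith

theorem IsSpectralThreshold.unique (hd : ∀ k, 0 ≤ d k) (hs : Summable d) {lam θ₁ θ₂ : ℝ}
    (hlam : 0 < lam) (h₁ : IsSpectralThreshold d N lam θ₁)
    (h₂ : IsSpectralThreshold d N lam θ₂) : θ₁ = θ₂ := by
  have h := h₁.sub_mul_inverseSlope hd hs h₂
  rw [sub_self, mul_eq_zero] at h
  have hpos := (div_pos hlam h₂.1).trans_le (h₂.le_inverseSlope hd hs h₁.1)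
  exact sub_eq_zero.1 (h.resolve_right hpos.ne')

/-- The threshold is differentiable, with derivative between `1` and `ϑ / lam`: its difference
quotients are the reciprocals of `inverseSlope`, which is continuous. -/
theorem exists_hasDerivAt_threshold (hd : ∀ k, 0 ≤ d k) (hs : Summable d) {τ : ℝ → ℝ}
    (hτ : ∀ l, 0 < l → IsSpectralThreshold d N l (τ l)) {lam : ℝ} (hlam : 0 < lam) :
    ∃ τ', HasDerivAt τ τ' lam ∧ 1 ≤ τ' ∧ τ' ≤ τ lam / lam := by
  have h0 := hτ lam hlam
  have hpos : 0 < lam / τ lam := div_pos hlam h0.1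
  have hnear : ∀ᶠ l in 𝓝 lam, 0 < l := lt_mem_nhds hlam
  have hslope : ∀ l, 0 < l → τ l - τ lam = (l - lam) * (inverseSlope d N (τ l) (τ lam))⁻¹ :=
    fun l hl => by
      have h1 := (hτ l hl).sub_mul_inverseSlope hd hs h0
      have h2 := hpos.trans_le (h0.le_inverseSlope hd hs (hτ l hl).1)
      rw [← h1, mul_assoc, mul_inv_cancel₀ h2.ne', mul_one]
  have hcont : Tendsto τ (𝓝 lam) (𝓝 (τ lam)) := by
    rw [tendsto_iff_norm_sub_tendsto_zero]
    have hz : Tendsto (fun l => |l - lam| * (lam / τ lam)⁻¹) (𝓝 lam) (𝓝 0) := by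
      have : Continuous fun l => |l - lam| * (lam / τ lam)⁻¹ := by fun_prop
      simpa using this.tendsto lam
    refine squeeze_zero' (.of_forall fun l => norm_nonneg _) (hnear.mono fun l hl => ?_) hz
    have h2 := h0.le_inverseSlope hd hs (hτ l hl).1
    rw [Real.norm_eq_abs, hslope l hl, abs_mul,
      abs_of_pos (inv_pos.2 (hpos.trans_le h2))]
    gcongr
  have htsum : Tendsto (fun l => ∑' k, d k ^ 2 / ((d k + τ l) * (d k + τ lam))) (𝓝 lam)
      (𝓝 (∑' k, d k ^ 2 / ((d k + τ lam) * (d k + τ lam)))) := by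
    refine tendsto_tsum_of_dominated_convergence (bound := fun k => d k / (d k + τ lam))
      (summable_div_add hd hs h0.1) (fun k => ?_) (hnear.mono fun l hl k => ?_)
    · have hne : (d k + τ lam) * (d k + τ lam) ≠ 0 :=
        mul_self_ne_zero.2 (add_pos_of_nonneg_of_pos (hd k) h0.1).ne'
      exact tendsto_const_nhds.div ((tendsto_const_nhds.add hcont).mul_const _) hne
    · have h := hd k
      have h1 := (hτ l hl).1
      have h2 := h0.1
      rw [Real.norm_of_nonneg (by positivity), pow_two, mul_div_mul_comm]
      exact mul_le_of_le_one_left (by positivity) (div_add_le_one h h1)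
  have hinv : Tendsto (fun l => inverseSlope d N (τ l) (τ lam)) (𝓝 lam)
      (𝓝 (inverseSlope d N (τ lam) (τ lam))) := tendsto_const_nhds.sub (htsum.div_const _)
  have hlow := h0.le_inverseSlope hd hs h0.1
  have hp := hpos.trans_le hlow
  refine ⟨(inverseSlope d N (τ lam) (τ lam))⁻¹, ?_, ?_, ?_⟩
  · rw [hasDerivAt_iff_tendsto_slope]
    have h1 := (hinv.inv₀ hp.ne').mono_left (nhdsWithin_le_nhds (s := {lam}ᶜ))
    refine h1.congr' ?_
    filter_upwards [self_mem_nhdsWithin, nhdsWithin_le_nhds hnear] with l hl hl0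
    have hne : l - lam ≠ 0 := sub_ne_zero.2 hl
    rw [slope_def_field, hslope l hl0, mul_comm, mul_div_cancel_right₀ _ hne]
  · exact (one_le_inv₀ hp).2 (inverseSlope_le_one hd h0.1 h0.1)
  · rw [← inv_div]
    exact inv_anti₀ hpos hlow

end Threshold

end KernelRidge

namespace KernelRidge

open Matrix

/-! ### Comparison with the approximate risk -/

section Comparison

variable {X : Type*} [TopologicalSpace X] {S : C(X, ℝ) →L[ℝ] C(X, ℝ) →L[ℝ] ℝ}
  {K : C(X × X, ℝ)} {ι : Type*} {d : ι → ℝ} {φ : ι → C(X, ℝ)} {N : ℕ}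

section RidgeRisk

theorem IsDiagonalization.summable_ridgeRisk (hK : IsDiagonalization K S d φ)
    (hS : IsScalarProduct S) {θ : ℝ} (hθ : 0 < θ) (f : C(X, ℝ)) :
    Summable fun k => S f (φ k) ^ 2 / (1 + d k / θ) ^ 2 := by
  refine Summable.of_nonneg_of_le (fun k => by positivity) (fun k => ?_)
    (hS.summable_sq hK.orthogonal hK.normalized f)
  refine div_le_self (sq_nonneg _) (one_le_pow₀ ?_)
  have := div_nonneg (hK.nonneg k) hθ.le
  linarith

theorem IsDiagonalization.tsum_sq_le (hK : IsDiagonalization K S d φ) (hS : IsScalarProduct S)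
    (f : C(X, ℝ)) : ∑' k, S f (φ k) ^ 2 ≤ S f f :=
  (hS.summable_sq hK.orthogonal hK.normalized f).tsum_le_of_sum_le
    (hS.sum_sq_le hK.orthogonal hK.normalized f)

theorem IsDiagonalization.ridgeRisk_nonneg (hK : IsDiagonalization K S d φ)
    (hS : IsScalarProduct S) (θ ε : ℝ) (f : C(X, ℝ)) : 0 ≤ ridgeRisk S d φ θ ε f := by
  have h1 := hK.tsum_sq_le hS f
  have h2 : 0 ≤ ∑' k, S f (φ k) ^ 2 / (1 + d k / θ) ^ 2 := tsum_nonneg fun k => by positivity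
  have h3 := sq_nonneg ε
  unfold ridgeRisk
  linarith

theorem IsDiagonalization.ridgeRisk_mono (hK : IsDiagonalization K S d φ)
    (hS : IsScalarProduct S) {θ₁ θ₂ : ℝ} (h₁ : 0 < θ₁) (h : θ₁ ≤ θ₂) (ε : ℝ) (f : C(X, ℝ)) :
    ridgeRisk S d φ θ₁ ε f ≤ ridgeRisk S d φ θ₂ ε f := by
  have h2 := (hK.summable_ridgeRisk hS h₁ f).tsum_le_tsum (fun k => ?_)
    (hK.summable_ridgeRisk hS (h₁.trans_le h) f)
  · unfold ridgeRisk
    linarith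
  · have hd := hK.nonneg k
    have hθ : 0 < θ₂ := h₁.trans_le h
    gcongr

theorem IsDiagonalization.ridgeRisk_le_mul (hK : IsDiagonalization K S d φ)
    (hS : IsScalarProduct S) {θ₁ θ₂ t : ℝ} (h₁ : 0 < θ₁) (h₂ : 0 < θ₂) (ht : 0 ≤ t)
    (h : θ₂ ≤ θ₁ * (1 + t)) (ε : ℝ) (f : C(X, ℝ)) :
    ridgeRisk S d φ θ₂ ε f ≤ (1 + t) ^ 2 * ridgeRisk S d φ θ₁ ε f := by
  have h2 := (hK.summable_ridgeRisk hS h₂ f).tsum_le_tsum (fun k => ?_)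
    ((hK.summable_ridgeRisk hS h₁ f).mul_left ((1 + t) ^ 2))
  · rw [tsum_mul_left] at h2
    have h3 : 1 ≤ (1 + t) ^ 2 := one_le_pow₀ (by linarith)
    have h4 : 0 ≤ S f f - ∑' k, S f (φ k) ^ 2 := sub_nonneg.2 (hK.tsum_sq_le hS f)
    have h5 := le_mul_of_one_le_left h4 h3
    have h6 := le_mul_of_one_le_left (sq_nonneg ε) h3
    unfold ridgeRisk
    linarith
  · have hd := hK.nonneg k
    have h3 : 1 + d k / θ₁ ≤ (1 + t) * (1 + d k / θ₂) := by
      have : d k / θ₁ ≤ (1 + t) * (d k / θ₂) := by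
        rw [mul_div_assoc', div_le_div_iff₀ h₁ h₂]
        calc d k * θ₂ ≤ d k * (θ₁ * (1 + t)) := by gcongr
          _ = _ := by ring
      linarith
    rw [mul_div_assoc', div_le_div_iff₀ (by positivity) (by positivity)]
    calc S f (φ k) ^ 2 * (1 + d k / θ₁) ^ 2
        ≤ S f (φ k) ^ 2 * ((1 + t) * (1 + d k / θ₂)) ^ 2 := by gcongr
      _ = _ := by ring

end RidgeRisk

variable [CompactSpace X] [T2Space X]

theorem IsDiagonalization.isThreshold_iff (hK : IsDiagonalization K S d φ)
    (hS : IsScalarProduct S) (lam θ : ℝ) :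
    IsThreshold K S φ N lam θ ↔ IsSpectralThreshold d N lam θ :=
  and_congr_right fun hθ => by rw [hK.opTrace_reconstruction hS hθ]

theorem IsDiagonalization.isSpectralThreshold_threshold (hK : IsDiagonalization K S d φ)
    (hS : IsScalarProduct S) (hN : 1 ≤ N) {lam : ℝ} (hlam : 0 < lam) :
    IsSpectralThreshold d N lam (threshold K S φ N lam) := by
  obtain ⟨θ, hθ⟩ := exists_isSpectralThreshold hK.nonneg hK.summable hN hlam
  rw [← hK.isThreshold_iff hS] at hθ ⊢
  exact Classical.epsilon_spec ⟨θ, hθ⟩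

theorem IsDiagonalization.existsUnique_isThreshold (hK : IsDiagonalization K S d φ)
    (hS : IsScalarProduct S) (hN : 1 ≤ N) {lam : ℝ} (hlam : 0 < lam) :
    ∃! θ : ℝ, IsThreshold K S φ N lam θ := by
  simp only [hK.isThreshold_iff hS]
  exact ⟨_, hK.isSpectralThreshold_threshold hS hN hlam, fun θ hθ =>
    hθ.unique hK.nonneg hK.summable hlam (hK.isSpectralThreshold_threshold hS hN hlam)⟩

theorem IsDiagonalization.approxRisk_eq (hK : IsDiagonalization K S d φ)
    (hS : IsScalarProduct S) (hN : 1 ≤ N) {lam : ℝ} (hlam : 0 < lam) (ε : ℝ) (f : C(X, ℝ)) :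
    approxRisk K S φ N lam ε f = deriv (threshold K S φ N) lam *
      ridgeRisk S d φ (threshold K S φ N lam) ε f := by
  unfold approxRisk residual ridgeRisk
  rw [hK.norm_sq_sub_reconstruction hS (hK.isSpectralThreshold_threshold hS hN hlam).1]

/-- Quantities that are close to `ridgeRisk` are close to the approximation of the training error,
since the threshold `ϑ` and its derivative satisfy `lam ≤ ϑ ≤ lam (1 + t)` and `1 ≤ ϑ' ≤ ϑ / lam`
with `t = Tr[T_K] / (lam N)`. -/
theorem IsDiagonalization.abs_sub_approxRisk_le (hK : IsDiagonalization K S d φ)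
    (hS : IsScalarProduct S) (hN : 1 ≤ N) {lam : ℝ} (hlam : 0 < lam) (ε : ℝ) (f : C(X, ℝ))
    {I q t : ℝ} (hq : 0 ≤ q) (ht : t = (∑' k, d k) / (lam * N))
    (hI : |I - ridgeRisk S d φ lam ε f| ≤ q * ridgeRisk S d φ lam ε f) :
    |I - lam ^ 2 / threshold K S φ N lam ^ 2 * approxRisk K S φ N lam ε f|
      ≤ (q + 2 * t) * approxRisk K S φ N lam ε f := by
  have hτ := hK.isSpectralThreshold_threshold hS hN hlam
  obtain ⟨τ', hder, h1, h2⟩ := exists_hasDerivAt_threshold hK.nonneg hK.summable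
    (fun l hl => hK.isSpectralThreshold_threshold hS hN hl) hlam
  have hle := hτ.le hK.nonneg
  have hle2 := hτ.le_add hK.nonneg hK.summable
  rw [hK.approxRisk_eq hS hN hlam, hder.deriv]
  set τ := threshold K S φ N lam
  have hN0 : (0 : ℝ) < N := by positivity
  have ht0 : 0 ≤ t := ht ▸ div_nonneg (tsum_nonneg hK.nonneg) (by positivity)
  have hle3 : τ ≤ lam * (1 + t) := by
    refine hle2.trans (le_of_eq ?_)
    rw [ht]
    field_simp
  have m1 := hK.ridgeRisk_mono hS hlam hle ε f
  have m2 := hK.ridgeRisk_le_mul hS hlam hτ.1 ht0 hle3 ε f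
  have hD1 := hK.ridgeRisk_nonneg hS τ ε f
  set D0 := ridgeRisk S d φ lam ε f
  set D1 := ridgeRisk S d φ τ ε f
  have hτ0 : 0 < τ := hτ.1
  have hs : 0 < (1 + t) ^ 2 := by positivity
  have hinv : 1 - 2 * t ≤ ((1 + t) ^ 2)⁻¹ := by
    rw [← one_div, le_div_iff₀ hs]
    have : 0 ≤ 3 * t ^ 2 + 2 * t ^ 3 := by positivity
    linarith
  have b1 : (1 - 2 * t) * D1 ≤ D0 :=
    calc (1 - 2 * t) * D1 ≤ ((1 + t) ^ 2)⁻¹ * D1 := by gcongr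
      _ ≤ ((1 + t) ^ 2)⁻¹ * ((1 + t) ^ 2 * D0) := by gcongr
      _ = D0 := by field_simp
  -- the prefactor `lam² ϑ' / ϑ²` lies between `1 / (1 + t)²` and `1`
  have hr1 : lam / τ ≤ 1 := (div_le_one hτ0).2 hle
  have c1 : lam ^ 2 / τ ^ 2 * τ' ≤ 1 :=
    calc lam ^ 2 / τ ^ 2 * τ' ≤ lam ^ 2 / τ ^ 2 * (τ / lam) := by gcongr
      _ = lam / τ := by field_simp
      _ ≤ 1 := hr1
  have c2 : ((1 + t) ^ 2)⁻¹ ≤ lam ^ 2 / τ ^ 2 * τ' :=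
    calc ((1 + t) ^ 2)⁻¹ = lam ^ 2 / (lam * (1 + t)) ^ 2 := by field_simp
      _ ≤ lam ^ 2 / τ ^ 2 := by gcongr
      _ ≤ lam ^ 2 / τ ^ 2 * τ' := le_mul_of_one_le_right (by positivity) h1
  have d1 : lam ^ 2 / τ ^ 2 * (τ' * D1) ≤ D1 := by
    rw [← mul_assoc]
    exact mul_le_of_le_one_left hD1 c1
  have d2 : (1 - 2 * t) * D1 ≤ lam ^ 2 / τ ^ 2 * (τ' * D1) := by
    rw [← mul_assoc]
    exact mul_le_mul_of_nonneg_right (hinv.trans c2) hD1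
  have fin : |I - lam ^ 2 / τ ^ 2 * (τ' * D1)| ≤ (q + 2 * t) * D1 := by
    have e1 : q * D0 ≤ q * D1 := by gcongr
    rw [abs_le] at hI ⊢
    constructor <;> linarith
  refine fin.trans (mul_le_mul_of_nonneg_left ?_ (by positivity))
  exact le_mul_of_one_le_left hD1 h1

/-- For observations in the dual space, the training risk has the spectral representation. -/
theorem IsDiagonalization.trainingRisk_eq (hK : IsDiagonalization K S d φ) (lam ε : ℝ)
    (f : C(X, ℝ)) (o : Fin N → C(X, ℝ) →L[ℝ] ℝ) (e : Fin N → ℝ) :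
    trainingRisk K lam ε f o e
      = spectralTrainingRisk d lam ε (fun i => o i f) (fun i k => o i (φ k)) e := by
  have happ : ∀ (i : Fin N) (μ : C(X, ℝ) →L[ℝ] ℝ),
      HasSum (fun k => d k * μ (φ k) * o i (φ k)) (o i (kernelMap K μ)) := fun i μ => by
    simpa using (hK.hasSum_kernelMap μ).mapL (o i)
  have hgram : gram K o = spectralGram d fun i k => o i (φ k) := by
    ext i j
    simp only [gram, spectralGram, of_apply]
    rw [← (happ i (o j)).tsum_eq]
    congr 1 with k
    ring
  have hadj : ∀ (i : Fin N) (w : Fin N → ℝ),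
      o i (kernelMap K (samplingAdjoint o w)) = (gram K o *ᵥ w) i := fun i w => by
    have h1 : HasSum (fun k => ∑ j, d k * o j (φ k) * o i (φ k) * w j)
        (∑ j, o i (kernelMap K (o j)) * w j) :=
      hasSum_sum fun j _ => (happ i (o j)).mul_right _
    refine (happ i _).unique ?_
    change HasSum _ (∑ j, o i (kernelMap K (o j)) * w j)
    convert h1 using 2 with k
    simp only [samplingAdjoint, _root_.sum_apply, _root_.smul_apply, smul_eq_mul, Finset.mul_sum,
      Finset.sum_mul]
    exact Finset.sum_congr rfl fun j _ => by ring
  unfold trainingRisk spectralTrainingRisk empiricalRisk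
  have hfit : ∀ y, sampling o (predictor K o lam y)
      = fittedValues (spectralGram d fun i k => o i (φ k)) lam y := fun y => by
    ext i
    simp only [sampling, predictor, fittedValues, map_smul, hadj, hgram, smul_mulVec,
      Pi.smul_apply]
  rw [hfit]
  rfl

/-- The polynomial `errorFactor t + 2 t`, which bounds the relative error in the theorem. -/
noncomputable def errorPolynomial : Polynomial ℝ :=
  Polynomial.C (4 + 2 * squareVariance) * Polynomial.X
    + Polynomial.C (4 * squareVariance) * Polynomial.X ^ 2

theorem errorPolynomial_eval (t : ℝ) : errorPolynomial.eval t = errorFactor t + 2 * t := by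
  simp only [errorPolynomial, errorFactor, Polynomial.eval_add, Polynomial.eval_mul,
    Polynomial.eval_C, Polynomial.eval_X, Polynomial.eval_pow]
  ring

theorem errorPolynomial_coeff_nonneg (n : ℕ) : 0 ≤ errorPolynomial.coeff n := by
  have hC := squareVariance_nonneg
  rw [errorPolynomial, Polynomial.coeff_add, Polynomial.coeff_C_mul, Polynomial.coeff_C_mul,
    Polynomial.coeff_X, Polynomial.coeff_X_pow]
  refine add_nonneg (mul_nonneg (by positivity) ?_) (mul_nonneg (by positivity) ?_) <;>
    split_ifs <;> norm_num

/-- The approximation of the mean training error, in the spectral representation. -/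
theorem IsNoisyGaussianSample.integrable_and_abs_integral_sub_approxRisk_le {Ω : Type*}
    [MeasurableSpace Ω] {P : Measure Ω} [IsProbabilityMeasure P] [Countable ι]
    {o : Fin N → C(X, ℝ) → Ω → ℝ} {ν : Measure ℝ} {e : Fin N → Ω → ℝ}
    (h : IsNoisyGaussianSample P S o ν e) (hK : IsDiagonalization K S d φ)
    (hS : IsScalarProduct S) (hN : 1 ≤ N) {lam : ℝ} (hlam : 0 < lam) (ε : ℝ) (f : C(X, ℝ)) :
    Integrable (fun ω => spectralTrainingRisk d lam ε
        (fun i => o i f ω) (fun i k => o i (φ k) ω) (fun i => e i ω)) P ∧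
      |∫ ω, spectralTrainingRisk d lam ε
          (fun i => o i f ω) (fun i k => o i (φ k) ω) (fun i => e i ω) ∂P -
          lam ^ 2 / threshold K S φ N lam ^ 2 * approxRisk K S φ N lam ε f| ≤
        errorPolynomial.eval (opTrace S φ (integralOperator K S) / (lam * N)) *
          approxRisk K S φ N lam ε f := by
  obtain ⟨h1, h2⟩ := h.abs_integral_spectralTrainingRisk_sub_le hS hK.orthogonal hK.normalized
    hK.nonneg hK.summable hN hlam ε f
  have ht : 0 ≤ (∑' k, d k) / (lam * N) := div_nonneg (tsum_nonneg hK.nonneg) (by positivity)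
  have hq : 0 ≤ errorFactor ((∑' k, d k) / (lam * N)) := by
    have := squareVariance_nonneg
    unfold errorFactor
    positivity
  rw [errorPolynomial_eval, hK.opTrace_integralOperator hS]
  exact ⟨h1, hK.abs_sub_approxRisk_le hS hN hlam ε f hq rfl h2⟩

end Comparison

end KernelRidge

theorem theorem7 :
    ∃ Q : Polynomial ℝ, (∀ n, 0 ≤ Q.coeff n) ∧ Q.eval 0 = 0 ∧
      ∀ {m : ℕ} (D : Set (EuclideanSpace ℝ (Fin m))) (_ : IsCompact D)
        (K : C(D × D, ℝ)) (S : C(D, ℝ) →L[ℝ] C(D, ℝ) →L[ℝ] ℝ)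
        {ι : Type} [Countable ι] (d : ι → ℝ) (φ : ι → C(D, ℝ))
        (_ : KernelRidge.IsScalarProduct S) (_ : KernelRidge.IsDiagonalization K S d φ)
        (N : ℕ) (_ : 1 ≤ N) (lam ε : ℝ) (_ : 0 < lam) (_ : 0 ≤ ε) (fstar : C(D, ℝ)),
        -- the objects in the approximation are well defined
        ((∀ θ : ℝ, 0 < θ →
            IsUnit (KernelRidge.integralOperator K S + θ • (1 : Module.End ℝ C(D, ℝ)))) ∧
          (∃! θ : ℝ, KernelRidge.IsThreshold K S φ N lam θ) ∧
          DifferentiableAt ℝ (KernelRidge.threshold K S φ N) lam) ∧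
        -- observations in the dual space of the continuous functions
        (∀ {Ω : Type*} [MeasurableSpace Ω] (P : Measure Ω) [IsProbabilityMeasure P]
          (o : Fin N → Ω → C(D, ℝ) →L[ℝ] ℝ) (ν : Measure ℝ) (e : Fin N → Ω → ℝ),
          KernelRidge.IsNoisyGaussianSample P S (fun i f ω => o i ω f) ν e →
            Integrable (fun ω => KernelRidge.trainingRisk K lam ε fstar
              (fun i => o i ω) (fun i => e i ω)) P ∧
            |∫ ω, KernelRidge.trainingRisk K lam ε fstar (fun i => o i ω) (fun i => e i ω) ∂P -
                lam ^ 2 / KernelRidge.threshold K S φ N lam ^ 2 *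
                  KernelRidge.approxRisk K S φ N lam ε fstar| ≤
              Q.eval (KernelRidge.opTrace S φ (KernelRidge.integralOperator K S) / (lam * N)) *
                KernelRidge.approxRisk K S φ N lam ε fstar) ∧
        -- Gaussian random linear forms that need not be bounded
        (∀ {Ω : Type*} [MeasurableSpace Ω] (P : Measure Ω) [IsProbabilityMeasure P]
          (o : Fin N → C(D, ℝ) → Ω → ℝ) (ν : Measure ℝ) (e : Fin N → Ω → ℝ),
          KernelRidge.IsNoisyGaussianSample P S o ν e →
            Integrable (fun ω => KernelRidge.spectralTrainingRisk d lam ε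
              (fun i => o i fstar ω) (fun i k => o i (φ k) ω) (fun i => e i ω)) P ∧
            |∫ ω, KernelRidge.spectralTrainingRisk d lam ε
                (fun i => o i fstar ω) (fun i k => o i (φ k) ω) (fun i => e i ω) ∂P -
                lam ^ 2 / KernelRidge.threshold K S φ N lam ^ 2 *
                  KernelRidge.approxRisk K S φ N lam ε fstar| ≤
              Q.eval (KernelRidge.opTrace S φ (KernelRidge.integralOperator K S) / (lam * N)) *
                KernelRidge.approxRisk K S φ N lam ε fstar) := by
  refine ⟨KernelRidge.errorPolynomial, KernelRidge.errorPolynomial_coeff_nonneg,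
    by simp [KernelRidge.errorPolynomial], ?_⟩
  intro m D hD K S ι _ d φ hS hK N hN lam ε hlam _ fstar
  have : CompactSpace D := isCompact_iff_compactSpace.1 hD
  obtain ⟨τ', hder, -, -⟩ := KernelRidge.exists_hasDerivAt_threshold hK.nonneg hK.summable
    (fun l hl => hK.isSpectralThreshold_threshold hS hN hl) hlam
  refine ⟨⟨fun θ hθ => hK.isUnit_add_smul hS hθ, hK.existsUnique_isThreshold hS hN hlam,
    hder.differentiableAt⟩, ?_, ?_⟩
  · intro Ω _ P _ o ν e h
    simp only [hK.trainingRisk_eq]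
    exact h.integrable_and_abs_integral_sub_approxRisk_le hK hS hN hlam ε fstar
  · intro Ω _ P _ o ν e h
    exact h.integrable_and_abs_integral_sub_approxRisk_le hK hS hN hlam ε fstar
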